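/- **Setting.** Let $n\ge 1$ be an integer, $p,\mu\in\mathbb R$ with $\mu\ge 0$, and let $I\subseteq\mathbb R$ be an open interval. For a probability density $f$ on $\mathbb R^n$ and $p>0$, $p\ne1$, let $H_p(f)=\frac1{1-p}\log\int_{\mathbb R^n}f^p\,dx$ be the $p$-th Rényi entropy and $N_p(f)=\exp\!\big(\frac{\mu}{n}H_p(f)\big)$ the $p$-th Rényi entropy power. Let $u=u(t,x)$, $t\in I$, $x\in\mathbb R^n$, be $C^\infty$ and strictly positive, with $\int_{\mathbb R^n}u(t,x)\,dx=1$ for every $t\in I$, and let it solve the nonlinear heat equation $\partial_t u=\Delta(u^p)$ on $I\times\mathbb R^n$. Suppose that $u$ decays at infinity in the following sense. For $s\in\mathbb R$, a *monomial of weight $s$ and total order $k$* is a function $u^{s}\prod_{i=1}^r\frac{\partial^{J_i}u}{u}$, where the $\partial^{J_i}$ are iterated partial derivatives in $x$ whose orders add up to $k$ (repetitions allowed). * (Boundary vanishing.) For every $t\in I$, every $a\in\{1,\dots,n\}$, and for $F$ any monomial of weight $3p-2$ and total order $3$, and for $F=u^{2p-2}\partial_{x_a}u$, $$\int_{\mathbb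 R^{n-1}}F\Big|_{x_a=-\infty}^{\infty}d^{(a)}x=0,$$ where $d^{(a)}x$ is integration in all the variables except $x_a$; that is, $\int_{\mathbb R^{n-1}}\big(F|_{x_a=R}-F|_{x_a=S}\big)d^{(a)}x\to0$ as $S\to-\infty$, $R\to\infty$. * (Convergence of the integrals.) $\int_{\mathbb R^n} u^p\,dx<\infty$ for every $t\in I$; and every monomial of weight $2p-1$ and total order $2$, and every monomial of weight $3p-2$ and total order $4$, is dominated, locally uniformly in $t\in I$, by an integrable function of $x$. **The formula $\Phi(n,p,\mu)$.** Put $n_1=\frac{9-\sqrt{17}}8$, $n_2=\frac{9+\sqrt{17}}8$, $n_3=\frac{\sqrt{17}+1}2$, $$\theta_1=-\tfrac{2n}{(p-1)^2},\quad \theta_2=\tfrac{2n^2p(9p-13)}{(p-1)^2(4n+9p-4)},\quad \theta_3=(\sqrt{17}-9)n,\quad \theta_4=\tfrac{n^2p-n^2-n\mu}{(p-1)^2},$$ $$\theta_5=\tfrac{n^2(9p^2-13p-4)-n(9p-4)\mu}{(p-1)^2(4n+9p-4)},\quad \theta_6=\tfrac{-4n(\sqrt{17}-1)\mu+8n^2}{\sqrt{17}+1},\quad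 \theta_7=n(1-p),\quad \theta_8=\tfrac{5n}9,\quad \theta_9=-\tfrac{162n}{25},$$ $$\theta_{10}=\tfrac{64n}{\sqrt{17}-9},\quad \theta_{11}=\tfrac{8(9\sqrt{17}+23)n^2}{-32n-49+9\sqrt{17}},\quad \theta_{12}=-\tfrac{16(11\sqrt{17}+47)n\mu+152n^2}{26\sqrt{17}\,n+73\sqrt{17}+118n+305},$$ $$\theta_{13}=-\tfrac{4n(\mu\sqrt{17}+2n+\mu)}{\sqrt{17}-1},\quad \theta_{14}=-\tfrac{8n(22\mu\sqrt{17}-19n-94\mu)}{26\sqrt{17}\,n+73\sqrt{17}-118n-305},\quad \theta_{15}=-\tfrac95n^2-\tfrac{81}{25}\mu n,\quad \theta_{16}=\tfrac{(\sqrt{17}-1)n}8,$$ and let $\phi_1$, $\phi_2$, $\phi_3$ be the conditions $p\ge1-\frac1n$, $\mu=2+n(p-1)$, $p>1-\frac1n$ respectively. Then $\Phi(n,p,\mu)$ is the disjunction of the following eight conditions: 1. $p>n_2$ and $[(\theta_4>\theta_1\wedge\theta_5\le0)\vee(\phi_1\wedge\phi_2)]$; 2. $p=n_2$ and $[(\theta_6>\theta_3\wedge\theta_{12}\le0)\vee(\phi_1\wedge\phi_2)]$;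 3. $\frac{13}9<p<n_2$ and $[(\theta_4>\theta_1\wedge\theta_5\le0)\vee(\phi_1\wedge\phi_2)]$; 4. $n_1<p\le\frac{13}9$, $p\ne1$ and $[(\phi_3\wedge\theta_4>\theta_1\wedge\theta_5\le\theta_2)\vee(\phi_3\wedge\theta_7\le\mu\wedge\theta_4>\theta_2)\vee(\phi_1\wedge\phi_2)]$; 5. $p=n_1$ and $[(n<n_3\wedge\theta_{13}>\theta_{10}\wedge\theta_{14}\le\theta_{11})\vee(n<n_3\wedge\theta_{13}>\theta_{11}\wedge\mu\ge\theta_{16})\vee(\phi_1\wedge\phi_2)]$; 6. $\frac49<p<n_1$ and $[(\phi_3\wedge\theta_4>\theta_1\wedge\theta_5\le\theta_2)\vee(\phi_3\wedge\theta_7\le\mu\wedge\theta_4>\theta_2)\vee(\phi_1\wedge\phi_2)]$; 7. $p=\frac49$ and $[(n=1\wedge\theta_{15}>\theta_9\wedge\mu\ge\theta_8)\vee(n=1\wedge-p\le\mu-1\le p)]$; 8. $0<p<\frac49$ and $[(n=1\wedge\theta_7\le\mu\wedge\theta_4>\theta_1)\vee(n=1\wedge\theta_5<\theta_1\wedge\mu\ge\theta_7)\vee(n=1\wedge-p\le\mu-1\le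 p)]$. (In particular $\Phi$ forces $p>0$ and $p\ne1$.) **Theorem.** If $\Phi(n,p,\mu)$ holds, then $t\mapsto N_p(u(t,\cdot))$ is twice differentiable on $I$, satisfies $$\frac{d^2}{dt^2}N_p(u(t,\cdot))\le0\qquad(t\in I),$$ and is concave on $I$. -/

import Mathlib

open MeasureTheory Filter Topology
open scoped ContDiff Laplacian

noncomputable section

/-! ### Rényi entropy and entropy power -/

/-- The `p`-th Rényi entropy `(1 / (1 - p)) log ∫ f ^ p` of a density on `ℝⁿ`. -/
def renyiEntropy {n : ℕ} (p : ℝ) (f : EuclideanSpace ℝ (Fin n) → ℝ) : ℝ :=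
  1 / (1 - p) * Real.log (∫ x, f x ^ p)

/-- The `p`-th Rényi entropy power with parameter `μ`: `exp ((μ / n) H_p(f))`. -/
def renyiEntropyPower {n : ℕ} (p μ : ℝ) (f : EuclideanSpace ℝ (Fin n) → ℝ) : ℝ :=
  Real.exp (μ / (n : ℝ) * renyiEntropy p f)

/-! ### Decaying solutions of the nonlinear heat equation -/

/-- The partial derivative of `f` in the `a`-th coordinate direction. -/
def partialDeriv {n : ℕ} (a : Fin n) (f : EuclideanSpace ℝ (Fin n) → ℝ) :
    EuclideanSpace ℝ (Fin n) → ℝ :=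
  fun x => fderiv ℝ f x (EuclideanSpace.single a 1)

/-- The iterated partial derivative of `f` along a list of coordinate directions; its order is the
length of the list. -/
def iterPartial {n : ℕ} : List (Fin n) → (EuclideanSpace ℝ (Fin n) → ℝ) →
    EuclideanSpace ℝ (Fin n) → ℝ
  | [], f => f
  | a :: J, f => partialDeriv a (iterPartial J f)

/-- The function `f ^ s · ∏ (∂^J f / f)`, the product being over the members `J` of the list `Js`
(so a factor may be repeated, which accounts for powers). -/
def weightedMonomial {n : ℕ} (s : ℝ) (Js : List (List (Fin n)))
    (f : EuclideanSpace ℝ (Fin n) → ℝ) : EuclideanSpace ℝ (Fin n) → ℝ :=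
  fun x => f x ^ s * (Js.map fun J => iterPartial J f x / f x).prod

/-- The sum of the orders of the derivatives in a monomial. -/
def totalOrder {n : ℕ} (Js : List (List (Fin n))) : ℕ :=
  (Js.map List.length).sum

/-- The point of `ℝⁿ` whose `a`-th coordinate is `r` and whose other coordinates are given
by `y`. -/
def pointWithCoord {n : ℕ} (a : Fin n) (r : ℝ) (y : {b : Fin n // b ≠ a} → ℝ) :
    EuclideanSpace ℝ (Fin n) :=
  WithLp.toLp 2 fun b => if h : b = a then r else y ⟨b, h⟩

/-- The boundary term `∫ F |_{x_a = -∞}^{∞} d^{(a)} x` vanishes: the integrals over the other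
`n - 1` variables of `F |_{x_a = R} - F |_{x_a = S}` tend to `0` as `S → -∞` and `R → ∞`. -/
def BoundaryTermVanishes {n : ℕ} (a : Fin n) (F : EuclideanSpace ℝ (Fin n) → ℝ) : Prop :=
  Tendsto
    (fun q : ℝ × ℝ => ∫ y : {b : Fin n // b ≠ a} → ℝ,
      (F (pointWithCoord a q.2 y) - F (pointWithCoord a q.1 y)))
    (atBot ×ˢ atTop) (𝓝 0)

/-- `G t x` is dominated by an integrable function of `x`, locally uniformly in the time `t`. -/
def LocallyDominated {n : ℕ} (I : Set ℝ) (G : ℝ → EuclideanSpace ℝ (Fin n) → ℝ) : Prop :=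
  ∀ t₀ ∈ I, ∃ g : EuclideanSpace ℝ (Fin n) → ℝ, Integrable g ∧
    ∀ᶠ t in 𝓝 t₀, ∀ x, |G t x| ≤ g x

/-- `u t x`, for `t` in the time interval `I`, is a smooth, strictly positive probability density on
`ℝⁿ` that solves `∂ₜ u = Δ (u ^ p)` and decays at infinity: the boundary terms of the integrations
by parts vanish, and the integrals that arise from `∫ u ^ p` and its first two time derivatives
converge, locally uniformly in time. -/
structure IsDecayingSolution {n : ℕ} (I : Set ℝ) (p : ℝ)
    (u : ℝ → EuclideanSpace ℝ (Fin n) → ℝ) : Prop where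
  smooth : ContDiffOn ℝ ∞ (fun q : ℝ × EuclideanSpace ℝ (Fin n) => u q.1 q.2) (I ×ˢ Set.univ)
  pos : ∀ t ∈ I, ∀ x, 0 < u t x
  integrable : ∀ t ∈ I, Integrable (u t)
  integral_eq_one : ∀ t ∈ I, ∫ x, u t x = 1
  equation : ∀ t ∈ I, ∀ x, deriv (fun s => u s x) t = Δ (fun y => u t y ^ p) x
  boundary_three : ∀ t ∈ I, ∀ a : Fin n, ∀ Js : List (List (Fin n)), totalOrder Js = 3 →
    BoundaryTermVanishes a (weightedMonomial (3 * p - 2) Js (u t))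
  boundary_one : ∀ t ∈ I, ∀ a : Fin n,
    BoundaryTermVanishes a (fun x => u t x ^ (2 * p - 2) * partialDeriv a (u t) x)
  integrable_rpow : ∀ t ∈ I, Integrable fun x => u t x ^ p
  dominated_two : ∀ Js : List (List (Fin n)), totalOrder Js = 2 →
    LocallyDominated I fun t => weightedMonomial (2 * p - 1) Js (u t)
  dominated_four : ∀ Js : List (List (Fin n)), totalOrder Js = 4 →
    LocallyDominated I fun t => weightedMonomial (3 * p - 2) Js (u t)

/-! ### The condition on the parameters -/

namespace RenyiParam

def n₁ : ℝ := (9 - √17) / 8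
def n₂ : ℝ := (9 + √17) / 8
def n₃ : ℝ := (√17 + 1) / 2

def θ₁ (n p : ℝ) : ℝ := -(2 * n / (p - 1) ^ 2)
def θ₂ (n p : ℝ) : ℝ := 2 * n ^ 2 * p * (9 * p - 13) / ((p - 1) ^ 2 * (4 * n + 9 * p - 4))
def θ₃ (n : ℝ) : ℝ := (√17 - 9) * n
def θ₄ (n p μ : ℝ) : ℝ := (n ^ 2 * p - n ^ 2 - n * μ) / (p - 1) ^ 2
def θ₅ (n p μ : ℝ) : ℝ :=
  (n ^ 2 * (9 * p ^ 2 - 13 * p - 4) - n * (9 * p - 4) * μ) / ((p - 1) ^ 2 * (4 * n + 9 * p - 4))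
def θ₆ (n μ : ℝ) : ℝ := (-4 * n * (√17 - 1) * μ + 8 * n ^ 2) / (√17 + 1)
def θ₇ (n p : ℝ) : ℝ := n * (1 - p)
def θ₈ (n : ℝ) : ℝ := 5 * n / 9
def θ₉ (n : ℝ) : ℝ := -(162 * n / 25)
def θ₁₀ (n : ℝ) : ℝ := 64 * n / (√17 - 9)
def θ₁₁ (n : ℝ) : ℝ := 8 * (9 * √17 + 23) * n ^ 2 / (-32 * n - 49 + 9 * √17)
def θ₁₂ (n μ : ℝ) : ℝ :=
  -((16 * (11 * √17 + 47) * n * μ + 152 * n ^ 2) / (26 * √17 * n + 73 * √17 + 118 * n + 305))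
def θ₁₃ (n μ : ℝ) : ℝ := -(4 * n * (μ * √17 + 2 * n + μ) / (√17 - 1))
def θ₁₄ (n μ : ℝ) : ℝ :=
  -(8 * n * (22 * μ * √17 - 19 * n - 94 * μ) / (26 * √17 * n + 73 * √17 - 118 * n - 305))
def θ₁₅ (n μ : ℝ) : ℝ := -(9 / 5) * n ^ 2 - 81 / 25 * μ * n
def θ₁₆ (n : ℝ) : ℝ := (√17 - 1) * n / 8

def φ₁ (n p : ℝ) : Prop := 1 - 1 / n ≤ p
def φ₂ (n p μ : ℝ) : Prop := μ = 2 + n * (p - 1)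
def φ₃ (n p : ℝ) : Prop := 1 - 1 / n < p

/-- The propositional formula `Φ(n, p, μ)`: one disjunct for each range of `p`. -/
def Φ (n p μ : ℝ) : Prop :=
  (n₂ < p ∧
    ((θ₁ n p < θ₄ n p μ ∧ θ₅ n p μ ≤ 0) ∨ (φ₁ n p ∧ φ₂ n p μ))) ∨
  (p = n₂ ∧
    ((θ₃ n < θ₆ n μ ∧ θ₁₂ n μ ≤ 0) ∨ (φ₁ n p ∧ φ₂ n p μ))) ∨
  ((13 / 9 < p ∧ p < n₂) ∧
    ((θ₁ n p < θ₄ n p μ ∧ θ₅ n p μ ≤ 0) ∨ (φ₁ n p ∧ φ₂ n p μ))) ∨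
  ((n₁ < p ∧ p ≤ 13 / 9 ∧ p ≠ 1) ∧
    ((φ₃ n p ∧ θ₁ n p < θ₄ n p μ ∧ θ₅ n p μ ≤ θ₂ n p) ∨
      (φ₃ n p ∧ θ₇ n p ≤ μ ∧ θ₂ n p < θ₄ n p μ) ∨ (φ₁ n p ∧ φ₂ n p μ))) ∨
  (p = n₁ ∧
    ((n < n₃ ∧ θ₁₀ n < θ₁₃ n μ ∧ θ₁₄ n μ ≤ θ₁₁ n) ∨
      (n < n₃ ∧ θ₁₁ n < θ₁₃ n μ ∧ θ₁₆ n ≤ μ) ∨ (φ₁ n p ∧ φ₂ n p μ))) ∨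
  ((4 / 9 < p ∧ p < n₁) ∧
    ((φ₃ n p ∧ θ₁ n p < θ₄ n p μ ∧ θ₅ n p μ ≤ θ₂ n p) ∨
      (φ₃ n p ∧ θ₇ n p ≤ μ ∧ θ₂ n p < θ₄ n p μ) ∨ (φ₁ n p ∧ φ₂ n p μ))) ∨
  (p = 4 / 9 ∧
    ((n = 1 ∧ θ₉ n < θ₁₅ n μ ∧ θ₈ n ≤ μ) ∨ (n = 1 ∧ -p ≤ μ - 1 ∧ μ - 1 ≤ p))) ∨
  ((0 < p ∧ p < 4 / 9) ∧
    ((n = 1 ∧ θ₇ n p ≤ μ ∧ θ₁ n p < θ₄ n p μ) ∨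
      (n = 1 ∧ θ₅ n p μ < θ₁ n p ∧ θ₇ n p ≤ μ) ∨ (n = 1 ∧ -p ≤ μ - 1 ∧ μ - 1 ≤ p)))

end RenyiParam

end

/-!
The condition `Φ` always forces `p ≠ 1`, `1 - 1 / n ≤ p` and `μ ≤ 2 + n (p - 1)`
(`RenyiParam.Φ.bounds`), and in this range the concavity follows from dissipation of the Fisher
information.

Let `E = ∫ u ^ p`, and let `v = p / (p - 1) * u ^ (p - 1)` be the pressure, so that the equation
reads `∂ₜ u = div (u ∇v)`. With `β = ∫ u ^ (2p - 3) |∇u|²`, integration by parts gives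
`E' = p² (1 - p) β` (`hasDerivAt_integral_rpow`) and, all third derivatives cancelling,
`β' = -2 (P + (p - 1) Y)` (`hasDerivAt_fisherInfo`), where `p² P = ∫ u ^ p |D²v|²` and
`p² Y = ∫ u ^ p (Δv)²`. The entropy power is `E ^ σ` with `σ = μ / (n (1 - p))`, so its second
derivative is a nonnegative multiple of `(μ / n + p - 1) p² β² + E β'`. The trace inequality
`Y ≤ n P` (`laplacianEnergy_le`) and the Cauchy–Schwarz inequality `p² β² ≤ E Y`, which is
`(∫ u ^ p Δv)² ≤ ∫ u ^ p * ∫ u ^ p (Δv)²` (`fisherInfo_sq_le`), bound this by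
`(μ / n - 2 / n - (p - 1)) p² β² ≤ 0`, the coefficient `1 / n + p - 1` being nonnegative.

Analytically, each integration by parts concerns a single monomial whose derivative is a combination
of dominated monomials; hence the derivative is integrable, and Fubini's theorem turns the vanishing
of the boundary term into the vanishing of its integral (`integral_eq_zero_of_boundaryTermVanishes`).
The factor `u ^ s` is carried as the weight of a monomial, so the remaining computations are
polynomial identities in the quotients `∂^J u / u`.
-/

/-! ### The range of the parameters -/

lemma RenyiParam.φ_bounds {n p μ : ℝ} (h₁ : RenyiParam.φ₁ n p)
    (h₂ : RenyiParam.φ₂ n p μ) : 1 - 1 / n ≤ p ∧ μ ≤ 2 + n * (p - 1) :=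
  ⟨h₁, le_of_eq h₂⟩

lemma RenyiParam.one_sub_inv_le_of_one_le {n p : ℝ} (hn : 1 ≤ n) (hp : 1 ≤ p) :
    1 - 1 / n ≤ p := by
  have : 0 ≤ 1 / n := by positivity
  linarith

lemma RenyiParam.le_of_θ₁_lt_θ₄ {n p μ : ℝ} (hn : 1 ≤ n) (hp : p ≠ 1)
    (h : RenyiParam.θ₁ n p < RenyiParam.θ₄ n p μ) : μ ≤ 2 + n * (p - 1) := by
  have hq : 0 < (p - 1) ^ 2 := by
    have : p - 1 ≠ 0 := sub_ne_zero.2 hp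
    positivity
  unfold RenyiParam.θ₁ RenyiParam.θ₄ at h
  rw [← neg_div, div_lt_div_iff_of_pos_right hq] at h
  nlinarith

/-- The difference `θ₂ - θ₁` has the sign of `(9p - 4) (n (p - 1) + 1)`. -/
lemma RenyiParam.le_of_θ₂_lt_θ₄ {n p μ : ℝ} (hn : 1 ≤ n) (hp : p ≠ 1) (hp' : 4 / 9 < p)
    (hφ : RenyiParam.φ₃ n p)
    (h : RenyiParam.θ₂ n p < RenyiParam.θ₄ n p μ) : μ ≤ 2 + n * (p - 1) := by
  refine RenyiParam.le_of_θ₁_lt_θ₄ hn hp (lt_of_le_of_lt ?_ h)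
  have hq : 0 < (p - 1) ^ 2 := by
    have : p - 1 ≠ 0 := sub_ne_zero.2 hp
    positivity
  have hr : 0 < 4 * n + 9 * p - 4 := by linarith
  have hs : 0 < n * (p - 1) + 1 := by
    unfold RenyiParam.φ₃ at hφ
    have h1 : n * (1 - 1 / n) < n * p := mul_lt_mul_of_pos_left hφ (by linarith)
    have h2 : n * (1 - 1 / n) = n - 1 := by field_simp
    linarith
  have key : RenyiParam.θ₂ n p - RenyiParam.θ₁ n p =
      2 * n * (9 * p - 4) * (n * (p - 1) + 1) / ((p - 1) ^ 2 * (4 * n + 9 * p - 4)) := by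
    have hq' := hq.ne'
    have hr' := hr.ne'
    unfold RenyiParam.θ₁ RenyiParam.θ₂
    rw [eq_div_iff (mul_ne_zero hq' hr'), sub_mul, div_mul_cancel₀ _ (mul_ne_zero hq' hr'),
      ← mul_assoc, neg_mul, div_mul_cancel₀ _ hq']
    ring
  have : 0 ≤ RenyiParam.θ₂ n p - RenyiParam.θ₁ n p := by
    rw [key]
    have : 0 < 9 * p - 4 := by linarith
    positivity
  linarith

/-- Every disjunct of `Φ` lies in the range of parameters covered by the trace and Cauchy–Schwarz
inequalities. The conditions `θ₁ < θ₄`, and their forms `θ₃ < θ₆`, `θ₁₀ < θ₁₃`, `θ₉ < θ₁₅`,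
`θ₅ < θ₁` in special cases, all say `μ < 2 + n (p - 1)`; the thresholds `θ₂`, `θ₁₁` are at least
`θ₁`, `θ₁₀`, so the conditions involving them are stronger. -/
lemma RenyiParam.Φ.bounds {n : ℕ} (hn : 1 ≤ n) {p μ : ℝ} (h : RenyiParam.Φ n p μ) :
    p ≠ 1 ∧ 1 - 1 / (n : ℝ) ≤ p ∧ μ ≤ 2 + n * (p - 1) := by
  have hn' : (1 : ℝ) ≤ n := by exact_mod_cast hn
  have s0 : (√17 : ℝ) ^ 2 = 17 := Real.sq_sqrt (by norm_num)
  have s1 : (4.12 : ℝ) < √17 := Real.lt_sqrt_of_sq_lt (by norm_num)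
  have s2 : (√17 : ℝ) < 4.124 := (Real.sqrt_lt' (by norm_num)).2 (by norm_num)
  rcases h with ⟨hp, h⟩ | ⟨hp, h⟩ | ⟨⟨hp, hp2⟩, h⟩ | ⟨⟨hp, hp2, hp1⟩, h⟩ | ⟨hp, h⟩ |
    ⟨⟨hp, hp2⟩, h⟩ | ⟨hp, h⟩ | ⟨⟨hp, hp2⟩, h⟩
  · unfold RenyiParam.n₂ at hp
    refine ⟨by linarith, ?_⟩
    rcases h with ⟨h, -⟩ | ⟨h, h'⟩
    · exact ⟨one_sub_inv_le_of_one_le hn' (by linarith), le_of_θ₁_lt_θ₄ hn' (by linarith) h⟩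
    · exact φ_bounds h h'
  · unfold RenyiParam.n₂ at hp
    refine ⟨by linarith, ?_⟩
    rcases h with ⟨h, -⟩ | ⟨h, h'⟩
    · refine ⟨one_sub_inv_le_of_one_le hn' (by linarith), ?_⟩
      -- clearing denominators with `√17 ^ 2 = 17` turns the condition into the bound on `μ`
      unfold RenyiParam.θ₃ RenyiParam.θ₆ at h
      rw [lt_div_iff₀ (by linarith)] at h
      have e : (√17 - 9) * n * (√17 + 1) = 8 * n * (1 - √17) := by linear_combination n * s0
      rw [e] at h
      have h3 : (n : ℝ) * (4 * ((√17 - 1) * μ)) < n * (8 * n + 8 * (√17 - 1)) := by linarith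
      have h4 := lt_of_mul_lt_mul_left h3 (by linarith)
      have h5 : (√17 - 1) * μ < (√17 - 1) * (2 + n * (p - 1)) := by
        have : (√17 - 1) * (2 + n * (p - 1)) = 2 * n + 2 * (√17 - 1) := by
          rw [hp]; linear_combination (n / 8 : ℝ) * s0
        linarith
      exact (lt_of_mul_lt_mul_left h5 (by linarith)).le
    · exact φ_bounds h h'
  · refine ⟨by linarith, ?_⟩
    rcases h with ⟨h, -⟩ | ⟨h, h'⟩
    · exact ⟨one_sub_inv_le_of_one_le hn' (by linarith), le_of_θ₁_lt_θ₄ hn' (by linarith) h⟩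
    · exact φ_bounds h h'
  · unfold RenyiParam.n₁ at hp
    refine ⟨hp1, ?_⟩
    rcases h with ⟨h, h', -⟩ | ⟨h, -, h'⟩ | ⟨h, h'⟩
    · exact ⟨le_of_lt h, le_of_θ₁_lt_θ₄ hn' hp1 h'⟩
    · exact ⟨le_of_lt h, le_of_θ₂_lt_θ₄ hn' hp1 (by linarith) h h'⟩
    · exact φ_bounds h h'
  · unfold RenyiParam.n₁ at hp
    refine ⟨by linarith, ?_⟩
    -- the only dimensions below `n₃` are `1` and `2`
    have small : (n : ℝ) < RenyiParam.n₃ → n = 1 ∨ n = 2 := by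
      intro h
      unfold RenyiParam.n₃ at h
      have : (n : ℝ) < 3 := by linarith
      have : n < 3 := by exact_mod_cast this
      omega
    have low : (n : ℝ) < RenyiParam.n₃ → 1 - 1 / (n : ℝ) ≤ p := by
      intro h
      rcases small h with rfl | rfl <;> norm_num <;> linarith
    have up : RenyiParam.θ₁₀ n < RenyiParam.θ₁₃ n μ → μ ≤ 2 + n * (p - 1) := by
      intro h
      unfold RenyiParam.θ₁₀ RenyiParam.θ₁₃ at h
      have e1 : 64 * (n : ℝ) / (√17 - 9) = n * (-9 - √17) := by
        rw [div_eq_iff (by linarith)]; linear_combination (n : ℝ) * s0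
      have e2 : -(4 * (n : ℝ) * (μ * √17 + 2 * n + μ) / (√17 - 1)) =
          n * (-((√17 + 1) ^ 2 * μ + 2 * n * (√17 + 1)) / 4) := by
        rw [← neg_div, div_eq_iff (by linarith)]
        linear_combination (n * (μ * (√17 + 1) + 2 * n) / 4 : ℝ) * s0
      rw [e1, e2] at h
      have h4 := lt_of_mul_lt_mul_left h (by linarith)
      have h5 : (√17 + 1) ^ 2 * μ < (√17 + 1) ^ 2 * (2 + n * (p - 1)) := by
        have : (√17 + 1) ^ 2 * (2 + n * (p - 1)) = 4 * (9 + √17) - 2 * n * (√17 + 1) := by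
          rw [hp]; linear_combination (2 - n / 8 - n * √17 / 8 : ℝ) * s0
        linarith
      exact (lt_of_mul_lt_mul_left h5 (by positivity)).le
    rcases h with ⟨h, h', -⟩ | ⟨h, h', -⟩ | ⟨h, h'⟩
    · exact ⟨low h, up h'⟩
    · refine ⟨low h, up (lt_of_le_of_lt ?_ h')⟩
      have hd : (0 : ℝ) < 9 - √17 := by linarith
      unfold RenyiParam.θ₁₀ RenyiParam.θ₁₁
      rw [show 64 * (n : ℝ) / (√17 - 9) = -(64 * n) / (9 - √17) by
          rw [← neg_sub, div_neg, neg_div],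
        show 8 * (9 * √17 + 23) * (n : ℝ) ^ 2 / (-32 * n - 49 + 9 * √17) =
          -(8 * (9 * √17 + 23) * (n : ℝ) ^ 2) / (32 * n + 49 - 9 * √17) by
          rw [show -32 * (n : ℝ) - 49 + 9 * √17 = -(32 * n + 49 - 9 * √17) by ring, div_neg,
            neg_div],
        div_le_div_iff₀ hd (by nlinarith)]
      rcases small h with rfl | rfl <;> push_cast <;> nlinarith
    · exact φ_bounds h h'
  · unfold RenyiParam.n₁ at hp2
    refine ⟨by linarith, ?_⟩
    rcases h with ⟨h, h', -⟩ | ⟨h, -, h'⟩ | ⟨h, h'⟩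
    · exact ⟨le_of_lt h, le_of_θ₁_lt_θ₄ hn' (by linarith) h'⟩
    · exact ⟨le_of_lt h, le_of_θ₂_lt_θ₄ hn' (by linarith) hp h h'⟩
    · exact φ_bounds h h'
  · subst hp
    refine ⟨by norm_num, ?_⟩
    rcases h with ⟨h, h', -⟩ | ⟨h, -, h'⟩
    · unfold RenyiParam.θ₉ RenyiParam.θ₁₅ at h'
      rw [h] at h' ⊢
      norm_num at h' ⊢
      linarith
    · rw [h]
      norm_num at h' ⊢
      linarith
  · have hp1 : p ≠ 1 := by linarith
    refine ⟨hp1, ?_⟩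
    rcases h with ⟨h, -, h'⟩ | ⟨h, h', -⟩ | ⟨h, -, h'⟩
    · refine ⟨?_, le_of_θ₁_lt_θ₄ hn' hp1 h'⟩
      rw [h]; norm_num; linarith
    · rw [h] at h' ⊢
      refine ⟨by norm_num; linarith, ?_⟩
      have hq : 0 < (p - 1) ^ 2 := by
        have : p - 1 ≠ 0 := sub_ne_zero.2 hp1
        positivity
      unfold RenyiParam.θ₁ RenyiParam.θ₅ at h'
      rw [← neg_div, div_lt_div_iff₀ (mul_pos hq (by norm_num; linarith)) hq] at h'
      have h2 : (p - 1) ^ 2 * ((9 * p - 4) * (p + 1)) < (p - 1) ^ 2 * ((9 * p - 4) * μ) := by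
        nlinarith
      have h3 := lt_of_mul_lt_mul_left h2 hq.le
      nlinarith
    · rw [h]
      exact ⟨by norm_num; linarith, by linarith⟩

/-! ### Integrals of partial derivatives -/

/-- Splitting off the `a`-th coordinate preserves Lebesgue measure. -/
lemma measurePreserving_pointWithCoord {n : ℕ} (a : Fin n) :
    MeasurePreserving
      (fun z : ℝ × ({b : Fin n // b ≠ a} → ℝ) => pointWithCoord a z.1 z.2) := by
  have h1 : MeasurePreserving
      (MeasurableEquiv.piEquivPiSubtypeProd (fun _ : Fin n => ℝ) (fun b => b = a)).symm := by
    convert (volume_preserving_piEquivPiSubtypeProd (fun _ : Fin n => ℝ) (fun b => b = a)).symm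
  have h2 := (volume_preserving_funUnique {b : Fin n // b = a} ℝ).symm
  have h3 : MeasurePreserving (Prod.map (MeasurableEquiv.funUnique {b : Fin n // b = a} ℝ).symm id)
      (volume : Measure (ℝ × ({b : Fin n // ¬ b = a} → ℝ)))
      (volume : Measure (({b : Fin n // b = a} → ℝ) × ({b : Fin n // ¬ b = a} → ℝ))) :=
    h2.prod (MeasurePreserving.id volume)
  have h4 := h1.comp h3
  have h5 := (PiLp.volume_preserving_toLp (Fin n)).comp h4
  exact h5

lemma measurableEmbedding_pointWithCoord {n : ℕ} (a : Fin n) :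
    MeasurableEmbedding
      (fun z : ℝ × ({b : Fin n // b ≠ a} → ℝ) => pointWithCoord a z.1 z.2) := by
  have h1 := (MeasurableEquiv.piEquivPiSubtypeProd (fun _ : Fin n => ℝ)
    (fun b => b = a)).symm.measurableEmbedding
  have h2 := ((MeasurableEquiv.funUnique {b : Fin n // b = a} ℝ).symm.prodCongr
    (MeasurableEquiv.refl ({b : Fin n // b ≠ a} → ℝ))).measurableEmbedding
  exact (MeasurableEquiv.toLp 2 (Fin n → ℝ)).measurableEmbedding.comp (h1.comp h2)

lemma pointWithCoord_eq_add {n : ℕ} (a : Fin n) (r s : ℝ) (y : {b : Fin n // b ≠ a} → ℝ) :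
    pointWithCoord a s y = pointWithCoord a r y + (s - r) • EuclideanSpace.single a 1 := by
  ext b
  by_cases h : b = a
  · subst h
    simp [pointWithCoord]
  · simp [pointWithCoord, h]

/-- An integrable partial derivative whose boundary term vanishes has integral zero. Integrability
makes the boundary integrals in `BoundaryTermVanishes` genuine ones, by Fubini. -/
lemma integral_eq_zero_of_boundaryTermVanishes {n : ℕ} {a : Fin n}
    {F G : EuclideanSpace ℝ (Fin n) → ℝ} (hF : BoundaryTermVanishes a F)
    (hG : Integrable G) (hGc : Continuous G)
    (hd : ∀ x, HasLineDerivAt ℝ F (G x) x (EuclideanSpace.single a 1)) :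
    ∫ x, G x = 0 := by
  have hΨ := measurePreserving_pointWithCoord a
  have hE := measurableEmbedding_pointWithCoord a
  have hi : Integrable (fun z : ℝ × ({b : Fin n // b ≠ a} → ℝ) => G (pointWithCoord a z.1 z.2))
      (volume.prod volume) := (hΨ.integrable_comp_emb hE).2 hG
  have hint : ∫ x, G x = ∫ r, ∫ y, G (pointWithCoord a r y) := by
    rw [← hΨ.integral_comp hE, Measure.volume_eq_prod, integral_prod _ hi]
  have hline : ∀ y r, HasDerivAt (fun r => F (pointWithCoord a r y))
      (G (pointWithCoord a r y)) r := by
    intro y r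
    have h := hd (pointWithCoord a r y)
    unfold HasLineDerivAt at h
    have h' := HasDerivAt.comp_sub_const (f := fun t => F (pointWithCoord a r y +
      t • EuclideanSpace.single a 1)) r r (by simpa using h)
    simpa only [← pointWithCoord_eq_add] using h'
  have hcont : ∀ y, Continuous fun r => G (pointWithCoord a r y) := by
    intro y
    have : (fun r => pointWithCoord a r y) = fun r : ℝ => pointWithCoord a 0 y +
        (r - 0) • EuclideanSpace.single a (1 : ℝ) := by
      ext1 r; exact pointWithCoord_eq_add a 0 r y
    refine hGc.comp ?_
    rw [this]
    fun_prop
  have hlim := intervalIntegral_tendsto_integral (l := (atBot : Filter ℝ) ×ˢ (atTop : Filter ℝ))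
    hi.integral_prod_left tendsto_fst tendsto_snd
  rw [hint]
  refine tendsto_nhds_unique (hlim.congr' ?_) hF
  have hle : ∀ᶠ q : ℝ × ℝ in atBot ×ˢ atTop, q.1 ≤ q.2 := by
    filter_upwards [(eventually_le_atBot (0 : ℝ)).prod_mk (eventually_ge_atTop (0 : ℝ))] with q hq
    exact hq.1.trans hq.2
  filter_upwards [hle] with q hq
  rw [intervalIntegral.integral_of_le hq, integral_integral_swap]
  · refine integral_congr_ae (Eventually.of_forall fun y => ?_)
    simp only
    rw [← intervalIntegral.integral_of_le hq]
    exact intervalIntegral.integral_eq_sub_of_hasDerivAt (fun r _ => hline y r)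
      ((hcont y).intervalIntegrable _ _)
  · have := hi.restrict (s := Set.Ioc q.1 q.2 ×ˢ Set.univ)
    rwa [← Measure.prod_restrict, Measure.restrict_univ] at this

variable {n : ℕ} {f : EuclideanSpace ℝ (Fin n) → ℝ}

/-! ### Partial derivatives and monomials in them -/

lemma contDiff_partialDeriv (hf : ContDiff ℝ ∞ f) (a : Fin n) : ContDiff ℝ ∞ (partialDeriv a f) :=
  (hf.fderiv_right (m := ∞) le_rfl).clm_apply contDiff_const

lemma contDiff_iterPartial (hf : ContDiff ℝ ∞ f) :
    ∀ J : List (Fin n), ContDiff ℝ ∞ (iterPartial J f)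
  | [] => hf
  | a :: J => contDiff_partialDeriv (contDiff_iterPartial hf J) a

lemma hasLineDerivAt_partialDeriv {x : EuclideanSpace ℝ (Fin n)} (hf : DifferentiableAt ℝ f x)
    (a : Fin n) : HasLineDerivAt ℝ f (partialDeriv a f x) x (EuclideanSpace.single a 1) :=
  hf.hasFDerivAt.hasLineDerivAt _

lemma partialDeriv_eq_of_hasLineDerivAt {x : EuclideanSpace ℝ (Fin n)}
    (hf : DifferentiableAt ℝ f x) {a : Fin n} {c : ℝ}
    (h : HasLineDerivAt ℝ f c x (EuclideanSpace.single a 1)) : partialDeriv a f x = c :=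
  (hasLineDerivAt_partialDeriv hf a).unique h

lemma hasLineDerivAt_iterPartial (hf : ContDiff ℝ ∞ f) (J : List (Fin n)) (a : Fin n)
    (x : EuclideanSpace ℝ (Fin n)) :
    HasLineDerivAt ℝ (iterPartial J f) (iterPartial (a :: J) f x) x (EuclideanSpace.single a 1) :=
  hasLineDerivAt_partialDeriv ((contDiff_iterPartial hf J).differentiable (by simp) x) a

lemma partialDeriv_comm (hf : ContDiff ℝ ∞ f) (a b : Fin n) :
    partialDeriv a (partialDeriv b f) = partialDeriv b (partialDeriv a f) := by
  have key : ∀ a b x, partialDeriv a (partialDeriv b f) x =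
      fderiv ℝ (fderiv ℝ f) x (EuclideanSpace.single a 1) (EuclideanSpace.single b 1) := by
    intro a b x
    have h : DifferentiableAt ℝ (fderiv ℝ f) x :=
      (hf.fderiv_right (m := ∞) le_rfl).differentiable (by simp) x
    unfold partialDeriv
    rw [fderiv_clm_apply h (by fun_prop)]
    simp
  ext x
  rw [key, key]
  exact (hf.contDiffAt.isSymmSndFDerivAt
    (by simpa using WithTop.coe_le_coe.2 (le_top : (2 : ℕ∞) ≤ ⊤))) _ _

lemma iterPartial_swap (hf : ContDiff ℝ ∞ f) (a b : Fin n) (J : List (Fin n)) :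
    iterPartial (a :: b :: J) f = iterPartial (b :: a :: J) f :=
  partialDeriv_comm (contDiff_iterPartial hf J) a b

lemma iterPartial_rotate (hf : ContDiff ℝ ∞ f) (a b : Fin n) :
    iterPartial [b, b, a] f = iterPartial [a, b, b] f := by
  rw [iterPartial_swap hf a b [b]]
  change partialDeriv b (iterPartial [b, a] f) = partialDeriv b (iterPartial [a, b] f)
  rw [iterPartial_swap hf b a []]

lemma weightedMonomial_cons (s : ℝ) (J : List (Fin n)) (Js : List (List (Fin n)))
    (x : EuclideanSpace ℝ (Fin n)) :
    weightedMonomial s (J :: Js) f x = iterPartial J f x / f x * weightedMonomial s Js f x := by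
  simp only [weightedMonomial, List.map_cons, List.prod_cons]
  ring

lemma contDiff_weightedMonomial (hf : ContDiff ℝ ∞ f) (hpos : ∀ x, 0 < f x) (s : ℝ)
    (Js : List (List (Fin n))) : ContDiff ℝ ∞ (weightedMonomial s Js f) := by
  have hne : ∀ x, f x ≠ 0 := fun x => (hpos x).ne'
  have h1 : ContDiff ℝ ∞ fun x => f x ^ s := hf.rpow_const_of_ne hne
  have h2 : ∀ Js : List (List (Fin n)),
      ContDiff ℝ ∞ fun x => (Js.map fun J => iterPartial J f x / f x).prod := by
    intro Js
    induction Js with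
    | nil => simpa using contDiff_const
    | cons J Js ih =>
      simp only [List.map_cons, List.prod_cons]
      exact ((contDiff_iterPartial hf J).div hf hne).mul ih
  exact h1.mul (h2 Js)

lemma HasDerivAt.rpow_const_of_pos {φ : ℝ → ℝ} {φ' τ : ℝ} (hφ : HasDerivAt φ φ' τ) (h0 : 0 < φ τ)
    (s : ℝ) : HasDerivAt (fun t => φ t ^ s) (s * φ τ ^ s * (φ' / φ τ)) τ := by
  convert hφ.rpow_const (p := s) (Or.inl h0.ne') using 1
  rw [Real.rpow_sub_one h0.ne']
  ring

lemma HasDerivAt.div_of_pos {φ ψ : ℝ → ℝ} {φ' ψ' τ : ℝ} (hφ : HasDerivAt φ φ' τ)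
    (hψ : HasDerivAt ψ ψ' τ) (h0 : 0 < φ τ) :
    HasDerivAt (fun t => ψ t / φ t) (ψ' / φ τ - ψ τ / φ τ * (φ' / φ τ)) τ := by
  have h0' := h0.ne'
  have e : ψ' / φ τ - ψ τ / φ τ * (φ' / φ τ) = (ψ' * φ τ - ψ τ * φ') / φ τ ^ 2 := by field_simp
  rw [e]
  exact hψ.fun_div hφ h0'

lemma hasLineDerivAt_weightedMonomial_nil (hf : ContDiff ℝ ∞ f) (hpos : ∀ x, 0 < f x) (s : ℝ)
    (a : Fin n) (x : EuclideanSpace ℝ (Fin n)) :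
    HasLineDerivAt ℝ (weightedMonomial s [] f) (s * weightedMonomial s [[a]] f x) x
      (EuclideanSpace.single a 1) := by
  have h0 := hasLineDerivAt_iterPartial hf [] a x
  unfold HasLineDerivAt at *
  have h := h0.rpow_const_of_pos (hpos _) s
  have e1 : (fun t : ℝ => weightedMonomial s [] f (x + t • EuclideanSpace.single a 1)) =
      fun t => iterPartial [] f (x + t • EuclideanSpace.single a 1) ^ s := by
    ext t; simp [weightedMonomial, iterPartial]
  have e2 : s * weightedMonomial s [[a]] f x =
      s * f x ^ s * (iterPartial [a] f x / f x) := by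
    simp [weightedMonomial]; ring
  rw [e1, e2]
  simpa only [zero_smul, add_zero, iterPartial] using h

lemma hasLineDerivAt_weightedMonomial_cons (hf : ContDiff ℝ ∞ f) (hpos : ∀ x, 0 < f x) {s : ℝ}
    {a : Fin n} {x : EuclideanSpace ℝ (Fin n)} {Js : List (List (Fin n))} {c : ℝ}
    (h : HasLineDerivAt ℝ (weightedMonomial s Js f) c x (EuclideanSpace.single a 1))
    (J : List (Fin n)) :
    HasLineDerivAt ℝ (weightedMonomial s (J :: Js) f)
      (weightedMonomial s ((a :: J) :: Js) f x - weightedMonomial s ([a] :: J :: Js) f x +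
        iterPartial J f x / f x * c) x (EuclideanSpace.single a 1) := by
  have h0 := hasLineDerivAt_iterPartial hf [] a x
  have hJ := hasLineDerivAt_iterPartial hf J a x
  unfold HasLineDerivAt at *
  have h' := (h0.div_of_pos hJ (hpos _)).fun_mul h
  simp only [zero_smul, add_zero] at h'
  simp only [weightedMonomial_cons]
  have e : iterPartial (a :: J) f x / f x * weightedMonomial s Js f x -
      iterPartial [a] f x / f x * (iterPartial J f x / f x * weightedMonomial s Js f x) +
      iterPartial J f x / f x * c =
      (iterPartial (a :: J) f x / f x - iterPartial J f x / f x * (iterPartial [a] f x / f x)) *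
        weightedMonomial s Js f x + iterPartial J f x / f x * c := by ring
  rw [e]
  exact h'

lemma hasLineDerivAt_weightedMonomial_one (hf : ContDiff ℝ ∞ f) (hpos : ∀ x, 0 < f x) (s : ℝ)
    (a : Fin n) (x : EuclideanSpace ℝ (Fin n)) (J : List (Fin n)) :
    HasLineDerivAt ℝ (weightedMonomial s [J] f)
      ((s - 1) * weightedMonomial s [[a], J] f x + weightedMonomial s [a :: J] f x) x
      (EuclideanSpace.single a 1) := by
  convert hasLineDerivAt_weightedMonomial_cons hf hpos
    (hasLineDerivAt_weightedMonomial_nil hf hpos s a x) J using 1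
  simp [weightedMonomial]; ring

lemma hasLineDerivAt_weightedMonomial_two (hf : ContDiff ℝ ∞ f) (hpos : ∀ x, 0 < f x) (s : ℝ)
    (a : Fin n) (x : EuclideanSpace ℝ (Fin n)) (J K : List (Fin n)) :
    HasLineDerivAt ℝ (weightedMonomial s [J, K] f)
      ((s - 2) * weightedMonomial s [[a], J, K] f x + weightedMonomial s [a :: J, K] f x +
        weightedMonomial s [J, a :: K] f x) x (EuclideanSpace.single a 1) := by
  convert hasLineDerivAt_weightedMonomial_cons hf hpos
    (hasLineDerivAt_weightedMonomial_one hf hpos s a x K) J using 1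
  simp [weightedMonomial]; ring

lemma hasLineDerivAt_weightedMonomial_three (hf : ContDiff ℝ ∞ f) (hpos : ∀ x, 0 < f x) (s : ℝ)
    (a : Fin n) (x : EuclideanSpace ℝ (Fin n)) (J K L : List (Fin n)) :
    HasLineDerivAt ℝ (weightedMonomial s [J, K, L] f)
      ((s - 3) * weightedMonomial s [[a], J, K, L] f x + weightedMonomial s [a :: J, K, L] f x +
        weightedMonomial s [J, a :: K, L] f x + weightedMonomial s [J, K, a :: L] f x) x
      (EuclideanSpace.single a 1) := by
  convert hasLineDerivAt_weightedMonomial_cons hf hpos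
    (hasLineDerivAt_weightedMonomial_two hf hpos s a x K L) J using 1
  simp [weightedMonomial]; ring

/-- The porous medium operator `Δ (f ^ p)` in terms of monomials of weight `p` and order `2`. -/
lemma laplacian_rpow (hf : ContDiff ℝ ∞ f) (hpos : ∀ x, 0 < f x) (p : ℝ)
    (x : EuclideanSpace ℝ (Fin n)) :
    Δ (fun y => f y ^ p) x = ∑ b, p * (weightedMonomial p [[b, b]] f x +
      (p - 1) * weightedMonomial p [[b], [b]] f x) := by
  have e0 : (fun y => f y ^ p) = weightedMonomial p [] f := by
    ext y; simp [weightedMonomial]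
  have hW := contDiff_weightedMonomial hf hpos p []
  have h1 : ∀ b, partialDeriv b (weightedMonomial p [] f) =
      fun y => p * weightedMonomial p [[b]] f y := fun b => funext fun y =>
    partialDeriv_eq_of_hasLineDerivAt (hW.differentiable (by simp) y)
      (hasLineDerivAt_weightedMonomial_nil hf hpos p b y)
  rw [e0, InnerProductSpace.laplacian_eq_iteratedFDeriv_orthonormalBasis _
    (EuclideanSpace.basisFun (Fin n) ℝ)]
  refine Finset.sum_congr rfl fun b _ => ?_
  have h2 : iteratedFDeriv ℝ 2 (weightedMonomial p [] f) x
      ![EuclideanSpace.basisFun (Fin n) ℝ b, EuclideanSpace.basisFun (Fin n) ℝ b] =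
      partialDeriv b (partialDeriv b (weightedMonomial p [] f)) x := by
    have hd : DifferentiableAt ℝ (fderiv ℝ (weightedMonomial p [] f)) x :=
      (hW.fderiv_right (m := ∞) le_rfl).differentiable (by simp) x
    unfold partialDeriv
    rw [iteratedFDeriv_two_apply, fderiv_clm_apply hd (by fun_prop)]
    simp
  rw [h2, h1]
  have h3 := hasLineDerivAt_weightedMonomial_one hf hpos p b x [b]
  rw [partialDeriv_eq_of_hasLineDerivAt (c := p * ((p - 1) * weightedMonomial p [[b], [b]] f x +
    weightedMonomial p [[b, b]] f x))]
  · ring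
  · exact ((contDiff_weightedMonomial hf hpos p [[b]]).differentiable (by simp) x).const_mul p
  · exact HasDerivAt.const_mul p h3

variable {I : Set ℝ} {p : ℝ} {u : ℝ → EuclideanSpace ℝ (Fin n) → ℝ}

/-! ### Derivatives in time and in space -/

lemma hasDerivAt_fst_of_differentiableAt {U : ℝ × EuclideanSpace ℝ (Fin n) → ℝ} {t : ℝ}
    {x : EuclideanSpace ℝ (Fin n)} (h : DifferentiableAt ℝ U (t, x)) :
    HasDerivAt (fun s => U (s, x)) (fderiv ℝ U (t, x) (1, 0)) t :=
  h.hasFDerivAt.comp_hasDerivAt t ((hasDerivAt_id t).prodMk (hasDerivAt_const t x))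

lemma hasFDerivAt_prodMk_right_comp {F : Type*} [NormedAddCommGroup F] [NormedSpace ℝ F]
    {U : ℝ × EuclideanSpace ℝ (Fin n) → F} {t : ℝ}
    {x : EuclideanSpace ℝ (Fin n)} (h : DifferentiableAt ℝ U (t, x)) :
    HasFDerivAt (fun y => U (t, y)) ((fderiv ℝ U (t, x)).comp
      (ContinuousLinearMap.inr ℝ ℝ (EuclideanSpace ℝ (Fin n)))) x :=
  h.hasFDerivAt.comp x (hasFDerivAt_prodMk_right t x)

lemma partialDeriv_eq_fderiv {U : ℝ × EuclideanSpace ℝ (Fin n) → ℝ} {t : ℝ}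
    {x : EuclideanSpace ℝ (Fin n)} (h : DifferentiableAt ℝ U (t, x)) (a : Fin n) :
    partialDeriv a (fun y => U (t, y)) x = fderiv ℝ U (t, x) (0, EuclideanSpace.single a 1) := by
  unfold partialDeriv
  rw [(hasFDerivAt_prodMk_right_comp h).fderiv]
  simp

lemma hasDerivAt_fderiv_apply {U : ℝ × EuclideanSpace ℝ (Fin n) → ℝ} {t : ℝ}
    {x : EuclideanSpace ℝ (Fin n)} (h : ContDiffAt ℝ ∞ U (t, x))
    (w : ℝ × EuclideanSpace ℝ (Fin n)) :
    HasDerivAt (fun s => fderiv ℝ U (s, x) w) (fderiv ℝ (fderiv ℝ U) (t, x) (1, 0) w) t := by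
  have hUU : DifferentiableAt ℝ (fderiv ℝ U) (t, x) :=
    (h.fderiv_right (m := ∞) le_rfl).differentiableAt (by simp)
  have h1 : HasDerivAt (fun s => fderiv ℝ U (s, x)) (fderiv ℝ (fderiv ℝ U) (t, x) (1, 0)) t :=
    hUU.hasFDerivAt.comp_hasDerivAt t ((hasDerivAt_id t).prodMk (hasDerivAt_const t x))
  simpa using h1.clm_apply (hasDerivAt_const t w)

/-- Time and space derivatives commute. -/
lemma partialDeriv_fderiv_eq {U : ℝ × EuclideanSpace ℝ (Fin n) → ℝ} {t : ℝ}
    {x : EuclideanSpace ℝ (Fin n)} (h : ContDiffAt ℝ ∞ U (t, x)) (a : Fin n) :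
    partialDeriv a (fun y => fderiv ℝ U (t, y) (1, 0)) x =
      fderiv ℝ (fderiv ℝ U) (t, x) (1, 0) (0, EuclideanSpace.single a 1) := by
  have hUU : DifferentiableAt ℝ (fderiv ℝ U) (t, x) :=
    (h.fderiv_right (m := ∞) le_rfl).differentiableAt (by simp)
  have h1 := (hasFDerivAt_prodMk_right_comp hUU).clm_apply
    (hasFDerivAt_const ((1, 0) : ℝ × EuclideanSpace ℝ (Fin n)) x)
  have hsymm : IsSymmSndFDerivAt ℝ U (t, x) := h.isSymmSndFDerivAt
    (by simpa using WithTop.coe_le_coe.2 (le_top : (2 : ℕ∞) ≤ ⊤))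
  unfold partialDeriv
  rw [h1.fderiv]
  simpa using hsymm _ _

/-! ### Regularity and integrability of decaying solutions -/

namespace IsDecayingSolution

lemma contDiffAt (hu : IsDecayingSolution I p u) (hI : IsOpen I) {t : ℝ} (ht : t ∈ I)
    (x : EuclideanSpace ℝ (Fin n)) :
    ContDiffAt ℝ ∞ (fun q : ℝ × EuclideanSpace ℝ (Fin n) => u q.1 q.2) (t, x) :=
  hu.smooth.contDiffAt ((hI.prod isOpen_univ).mem_nhds ⟨ht, trivial⟩)

lemma contDiff (hu : IsDecayingSolution I p u) (hI : IsOpen I) {t : ℝ} (ht : t ∈ I) :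
    ContDiff ℝ ∞ (u t) :=
  contDiff_iff_contDiffAt.2 fun x =>
    (hu.contDiffAt hI ht x).comp x (contDiffAt_const.prodMk contDiffAt_id)

lemma continuous_weightedMonomial (hu : IsDecayingSolution I p u) (hI : IsOpen I) {t : ℝ}
    (ht : t ∈ I) (s : ℝ) (Js : List (List (Fin n))) : Continuous (weightedMonomial s Js (u t)) :=
  (contDiff_weightedMonomial (hu.contDiff hI ht) (hu.pos t ht) s Js).continuous

lemma integrable_of_locallyDominated (hu : IsDecayingSolution I p u) (hI : IsOpen I) {t : ℝ}
    (ht : t ∈ I) {s : ℝ} {Js : List (List (Fin n))}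
    (h : LocallyDominated I fun t => weightedMonomial s Js (u t)) :
    Integrable (weightedMonomial s Js (u t)) := by
  obtain ⟨g, hg, hb⟩ := h t ht
  exact hg.mono' (hu.continuous_weightedMonomial hI ht s Js).aestronglyMeasurable
    (Eventually.of_forall hb.self_of_nhds)

lemma integrable_two (hu : IsDecayingSolution I p u) (hI : IsOpen I) {t : ℝ} (ht : t ∈ I)
    {Js : List (List (Fin n))} (h : totalOrder Js = 2) :
    Integrable (weightedMonomial (2 * p - 1) Js (u t)) :=
  hu.integrable_of_locallyDominated hI ht (hu.dominated_two Js h)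

lemma integrable_four (hu : IsDecayingSolution I p u) (hI : IsOpen I) {t : ℝ} (ht : t ∈ I)
    {Js : List (List (Fin n))} (h : totalOrder Js = 4) :
    Integrable (weightedMonomial (3 * p - 2) Js (u t)) :=
  hu.integrable_of_locallyDominated hI ht (hu.dominated_four Js h)

/-! ### Integration by parts -/

/-- Integration by parts for `u ^ (2p - 2) ∂ₐu`, which is a monomial of weight `2p - 1`. -/
lemma integral_parts_one (hu : IsDecayingSolution I p u) (hI : IsOpen I) {t : ℝ} (ht : t ∈ I)
    (a : Fin n) :
    (2 * p - 2) * (∫ x, weightedMonomial (2 * p - 1) [[a], [a]] (u t) x) +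
      ∫ x, weightedMonomial (2 * p - 1) [[a, a]] (u t) x = 0 := by
  have hc := hu.continuous_weightedMonomial hI ht (2 * p - 1)
  have i1 := hu.integrable_two hI ht (Js := [[a], [a]]) rfl
  have i2 := hu.integrable_two hI ht (Js := [[a, a]]) rfl
  have hF : BoundaryTermVanishes a (weightedMonomial (2 * p - 1) [[a]] (u t)) := by
    convert hu.boundary_one t ht a using 1
    ext x
    have h0 := hu.pos t ht x
    rw [show 2 * p - 2 = 2 * p - 1 - 1 by ring, Real.rpow_sub_one h0.ne']
    simp [weightedMonomial, iterPartial]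
    ring
  rw [← integral_const_mul, ← integral_add (i1.const_mul _) i2]
  refine integral_eq_zero_of_boundaryTermVanishes hF ((i1.const_mul _).add i2)
    ((continuous_const.mul (hc _)).add (hc _)) fun x => ?_
  have h := hasLineDerivAt_weightedMonomial_one (hu.contDiff hI ht) (hu.pos t ht) (2 * p - 1) a x
    [a]
  rwa [show 2 * p - 1 - 1 = 2 * p - 2 by ring] at h

lemma integral_parts_two (hu : IsDecayingSolution I p u) (hI : IsOpen I) {t : ℝ} (ht : t ∈ I)
    (a : Fin n) (J K : List (Fin n)) (hJK : totalOrder [J, K] = 3) :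
    (3 * p - 4) * (∫ x, weightedMonomial (3 * p - 2) [[a], J, K] (u t) x) +
      (∫ x, weightedMonomial (3 * p - 2) [a :: J, K] (u t) x) +
      ∫ x, weightedMonomial (3 * p - 2) [J, a :: K] (u t) x = 0 := by
  have hc := hu.continuous_weightedMonomial hI ht (3 * p - 2)
  simp only [totalOrder, List.map_cons, List.map_nil, List.sum_cons, List.sum_nil] at hJK
  have i1 := hu.integrable_four hI ht (Js := [[a], J, K]) (by simp [totalOrder]; omega)
  have i2 := hu.integrable_four hI ht (Js := [a :: J, K]) (by simp [totalOrder]; omega)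
  have i3 := hu.integrable_four hI ht (Js := [J, a :: K]) (by simp [totalOrder]; omega)
  have hF := hu.boundary_three t ht a [J, K] (by simp [totalOrder]; omega)
  have i12 : Integrable fun x => (3 * p - 4) * weightedMonomial (3 * p - 2) [[a], J, K] (u t) x +
      weightedMonomial (3 * p - 2) [a :: J, K] (u t) x := (i1.const_mul _).add i2
  rw [← integral_const_mul, ← integral_add (i1.const_mul _) i2, ← integral_add i12 i3]
  refine integral_eq_zero_of_boundaryTermVanishes hF (i12.add i3)
    (((continuous_const.mul (hc _)).add (hc _)).add (hc _)) fun x => ?_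
  have h := hasLineDerivAt_weightedMonomial_two (hu.contDiff hI ht) (hu.pos t ht) (3 * p - 2) a x
    J K
  rwa [show 3 * p - 2 - 2 = 3 * p - 4 by ring] at h

lemma integral_parts_three (hu : IsDecayingSolution I p u) (hI : IsOpen I) {t : ℝ} (ht : t ∈ I)
    (a : Fin n) (J K L : List (Fin n)) (hJK : totalOrder [J, K, L] = 3) :
    (3 * p - 5) * (∫ x, weightedMonomial (3 * p - 2) [[a], J, K, L] (u t) x) +
      (∫ x, weightedMonomial (3 * p - 2) [a :: J, K, L] (u t) x) +
      (∫ x, weightedMonomial (3 * p - 2) [J, a :: K, L] (u t) x) +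
      ∫ x, weightedMonomial (3 * p - 2) [J, K, a :: L] (u t) x = 0 := by
  have hc := hu.continuous_weightedMonomial hI ht (3 * p - 2)
  simp only [totalOrder, List.map_cons, List.map_nil, List.sum_cons, List.sum_nil] at hJK
  have i1 := hu.integrable_four hI ht (Js := [[a], J, K, L]) (by simp [totalOrder]; omega)
  have i2 := hu.integrable_four hI ht (Js := [a :: J, K, L]) (by simp [totalOrder]; omega)
  have i3 := hu.integrable_four hI ht (Js := [J, a :: K, L]) (by simp [totalOrder]; omega)
  have i4 := hu.integrable_four hI ht (Js := [J, K, a :: L]) (by simp [totalOrder]; omega)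
  have hF := hu.boundary_three t ht a [J, K, L] (by simp [totalOrder]; omega)
  have i12 : Integrable fun x =>
      (3 * p - 5) * weightedMonomial (3 * p - 2) [[a], J, K, L] (u t) x +
      weightedMonomial (3 * p - 2) [a :: J, K, L] (u t) x := (i1.const_mul _).add i2
  have i123 : Integrable fun x =>
      (3 * p - 5) * weightedMonomial (3 * p - 2) [[a], J, K, L] (u t) x +
      weightedMonomial (3 * p - 2) [a :: J, K, L] (u t) x +
      weightedMonomial (3 * p - 2) [J, a :: K, L] (u t) x := i12.add i3
  rw [← integral_const_mul, ← integral_add (i1.const_mul _) i2, ← integral_add i12 i3,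
    ← integral_add i123 i4]
  refine integral_eq_zero_of_boundaryTermVanishes hF (i123.add i4)
    ((((continuous_const.mul (hc _)).add (hc _)).add (hc _)).add (hc _)) fun x => ?_
  have h := hasLineDerivAt_weightedMonomial_three (hu.contDiff hI ht) (hu.pos t ht) (3 * p - 2) a
    x J K L
  rwa [show 3 * p - 2 - 3 = 3 * p - 5 by ring] at h

/-! ### The evolution of the solution and of its gradient -/

/-- The right-hand side of the equation, written with monomials of order two. -/
lemma hasDerivAt (hu : IsDecayingSolution I p u) (hI : IsOpen I) {t : ℝ} (ht : t ∈ I)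
    (x : EuclideanSpace ℝ (Fin n)) :
    HasDerivAt (fun s => u s x) (∑ b, p * (weightedMonomial p [[b, b]] (u t) x +
      (p - 1) * weightedMonomial p [[b], [b]] (u t) x)) t := by
  have hd : DifferentiableAt ℝ (fun s => u s x) t :=
    ((hu.contDiffAt hI ht x).comp t (contDiffAt_id.prodMk contDiffAt_const)).differentiableAt
      (by simp)
  rw [← laplacian_rpow (hu.contDiff hI ht) (hu.pos t ht), ← hu.equation t ht x]
  exact hd.hasDerivAt

lemma hasDerivAt_partialDeriv (hu : IsDecayingSolution I p u) (hI : IsOpen I) {t : ℝ}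
    (ht : t ∈ I) (x : EuclideanSpace ℝ (Fin n)) (a : Fin n) :
    HasDerivAt (fun s => partialDeriv a (u s) x)
      (partialDeriv a (fun y => ∑ b, p * (weightedMonomial p [[b, b]] (u t) y +
        (p - 1) * weightedMonomial p [[b], [b]] (u t) y)) x) t := by
  have hUd : ∀ s ∈ I, ∀ y, DifferentiableAt ℝ (fun q : ℝ × EuclideanSpace ℝ (Fin n) => u q.1 q.2)
      (s, y) := fun s hs y => (hu.contDiffAt hI hs y).differentiableAt (by simp)
  have htime : (fun y => ∑ b, p * (weightedMonomial p [[b, b]] (u t) y +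
        (p - 1) * weightedMonomial p [[b], [b]] (u t) y)) =
      fun y => fderiv ℝ (fun q : ℝ × EuclideanSpace ℝ (Fin n) => u q.1 q.2) (t, y) (1, 0) :=
    funext fun y => (hu.hasDerivAt hI ht y).unique (hasDerivAt_fst_of_differentiableAt (hUd t ht y))
  rw [htime, partialDeriv_fderiv_eq (hu.contDiffAt hI ht x)]
  have h2 := hasDerivAt_fderiv_apply (hu.contDiffAt hI ht x) (0, EuclideanSpace.single a 1)
  refine h2.congr_of_eventuallyEq ?_
  filter_upwards [hI.mem_nhds ht] with s hs
  exact partialDeriv_eq_fderiv (hUd s hs x) a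

/-- The partial derivatives of the right-hand side of the equation. -/
lemma partialDeriv_rhs (hu : IsDecayingSolution I p u) (hI : IsOpen I) {t : ℝ}
    (ht : t ∈ I) (x : EuclideanSpace ℝ (Fin n)) (a : Fin n) :
    partialDeriv a (fun y => ∑ b, p * (weightedMonomial p [[b, b]] (u t) y +
        (p - 1) * weightedMonomial p [[b], [b]] (u t) y)) x =
      ∑ b, p * ((p - 1) * weightedMonomial p [[a], [b, b]] (u t) x +
        weightedMonomial p [[a, b, b]] (u t) x +
        (p - 1) * ((p - 2) * weightedMonomial p [[a], [b], [b]] (u t) x +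
          2 * weightedMonomial p [[b], [a, b]] (u t) x)) := by
  have hf := hu.contDiff hI ht
  have hpos := hu.pos t ht
  have hW : ∀ Js, ContDiff ℝ ∞ (weightedMonomial p Js (u t)) :=
    contDiff_weightedMonomial hf hpos p
  refine partialDeriv_eq_of_hasLineDerivAt ?_ ?_
  · refine ContDiff.differentiable (n := ∞) ?_ (by simp) x
    exact ContDiff.sum fun b _ => contDiff_const.mul ((hW _).add (contDiff_const.mul (hW _)))
  · refine HasDerivAt.fun_sum fun b _ => HasDerivAt.const_mul p (HasDerivAt.add
      (hasLineDerivAt_weightedMonomial_one hf hpos p a x [b, b]) (HasDerivAt.const_mul (p - 1) ?_))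
    have h := hasLineDerivAt_weightedMonomial_two hf hpos p a x [b] [b]
    have e : weightedMonomial p [[a, b], [b]] (u t) x =
        weightedMonomial p [[b], [a, b]] (u t) x := by
      simp [weightedMonomial, mul_comm]
    rw [e, add_assoc, ← two_mul] at h
    exact h

end IsDecayingSolution

/-! ### Polynomials in the derivatives -/

/-- The linear combination `∑ c · u ^ s ∏ (∂^J u / u)` of monomials of weight `s` given by a list
of coefficients and monomials. -/
noncomputable def weightedPolynomial {n : ℕ} (s : ℝ) (L : List (ℝ × List (List (Fin n))))
    (f : EuclideanSpace ℝ (Fin n) → ℝ) (x : EuclideanSpace ℝ (Fin n)) : ℝ :=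
  (L.map fun z => z.1 * weightedMonomial s z.2 f x).sum

/-- Up to the factor `p u ^ (p - 1)`, the Hessian of the pressure `p / (p - 1) * u ^ (p - 1)`. -/
noncomputable def pressureHessian {n : ℕ} (p : ℝ) (f : EuclideanSpace ℝ (Fin n) → ℝ) (a b : Fin n)
    (x : EuclideanSpace ℝ (Fin n)) : ℝ :=
  iterPartial [a, b] f x / f x + (p - 2) * (iterPartial [a] f x / f x * (iterPartial [b] f x / f x))

/-- The Fisher information `∫ u ^ (2p - 3) |∇u|²`, which drives the evolution of `∫ u ^ p`. -/
noncomputable def fisherInfo {n : ℕ} (p : ℝ) (f : EuclideanSpace ℝ (Fin n) → ℝ) : ℝ :=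
  ∑ a, ∫ x, weightedMonomial (2 * p - 1) [[a], [a]] f x

/-- Up to the factor `p ^ 2`, the integral `∫ u ^ p |D²v|²` for the pressure `v`. -/
noncomputable def hessianEnergy {n : ℕ} (p : ℝ) (f : EuclideanSpace ℝ (Fin n) → ℝ) : ℝ :=
  ∫ x, f x ^ (3 * p - 2) * ∑ a, ∑ b, pressureHessian p f a b x ^ 2

/-- Up to the factor `p ^ 2`, the integral `∫ u ^ p (Δv)²` for the pressure `v`. -/
noncomputable def laplacianEnergy {n : ℕ} (p : ℝ) (f : EuclideanSpace ℝ (Fin n) → ℝ) : ℝ :=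
  ∫ x, f x ^ (3 * p - 2) * (∑ a, pressureHessian p f a a x) ^ 2

lemma LocallyDominated.add {F G : ℝ → EuclideanSpace ℝ (Fin n) → ℝ} (hF : LocallyDominated I F)
    (hG : LocallyDominated I G) : LocallyDominated I fun t x => F t x + G t x := by
  intro t ht
  obtain ⟨f, hf, hf'⟩ := hF t ht
  obtain ⟨g, hg, hg'⟩ := hG t ht
  refine ⟨_, hf.add hg, ?_⟩
  filter_upwards [hf', hg'] with s h1 h2 x
  exact (abs_add_le _ _).trans (add_le_add (h1 x) (h2 x))

lemma LocallyDominated.const_mul {F : ℝ → EuclideanSpace ℝ (Fin n) → ℝ}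
    (hF : LocallyDominated I F) (c : ℝ) : LocallyDominated I fun t x => c * F t x := by
  intro t ht
  obtain ⟨f, hf, hf'⟩ := hF t ht
  refine ⟨_, hf.const_mul |c|, ?_⟩
  filter_upwards [hf'] with s h1 x
  rw [abs_mul]
  exact mul_le_mul_of_nonneg_left (h1 x) (abs_nonneg c)

lemma locallyDominated_zero :
    LocallyDominated I fun _ (_ : EuclideanSpace ℝ (Fin n)) => (0 : ℝ) :=
  fun _ _ => ⟨fun _ => 0, integrable_zero _ _ _, by simp⟩

lemma LocallyDominated.sum {ι : Type*} (S : Finset ι) {F : ι → ℝ → EuclideanSpace ℝ (Fin n) → ℝ}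
    (hF : ∀ i, LocallyDominated I (F i)) : LocallyDominated I fun t x => ∑ i ∈ S, F i t x := by
  classical
  induction S using Finset.induction_on with
  | empty => simpa using locallyDominated_zero
  | insert i S hi ih => simpa [Finset.sum_insert hi] using (hF i).add ih

lemma locallyDominated_weightedPolynomial {s : ℝ} {L : List (ℝ × List (List (Fin n)))}
    (h : ∀ z ∈ L, LocallyDominated I fun t => weightedMonomial s z.2 (u t)) :
    LocallyDominated I fun t => weightedPolynomial s L (u t) := by
  induction L with
  | nil => exact locallyDominated_zero
  | cons z L ih =>
    exact ((h z (by simp)).const_mul z.1).add (ih fun w hw => h w (by simp [hw]))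

/-- Differentiation under the integral sign for a locally dominated time derivative. -/
lemma hasDerivAt_integral_of_locallyDominated (hI : IsOpen I) {t : ℝ} (ht : t ∈ I)
    {F F' : ℝ → EuclideanSpace ℝ (Fin n) → ℝ} (hF : ∀ s ∈ I, Continuous (F s))
    (hFt : Integrable (F t)) (hF' : Continuous (F' t)) (hdom : LocallyDominated I F')
    (hd : ∀ s ∈ I, ∀ x, HasDerivAt (fun s => F s x) (F' s x) s) :
    HasDerivAt (fun s => ∫ x, F s x) (∫ x, F' t x) t := by
  obtain ⟨g, hg, hb⟩ := hdom t ht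
  refine (hasDerivAt_integral_of_dominated_loc_of_deriv_le (bound := g)
    (Filter.inter_mem hb (hI.mem_nhds ht)) ?_ hFt hF'.aestronglyMeasurable ?_ hg ?_).2
  · filter_upwards [hI.mem_nhds ht] with s hs
    exact (hF s hs).aestronglyMeasurable
  · exact Eventually.of_forall fun x s hs => hs.1 x
  · exact Eventually.of_forall fun x s hs => hd s hs.2 x

lemma integrable_weightedPolynomial {s : ℝ} {L : List (ℝ × List (List (Fin n)))}
    {f : EuclideanSpace ℝ (Fin n) → ℝ} (h : ∀ z ∈ L, Integrable (weightedMonomial s z.2 f)) :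
    Integrable (weightedPolynomial s L f) := by
  induction L with
  | nil => exact integrable_zero _ _ _
  | cons z L ih =>
    exact ((h z (by simp)).const_mul z.1).add (ih fun w hw => h w (by simp [hw]))

lemma integral_weightedPolynomial {s : ℝ} {L : List (ℝ × List (List (Fin n)))}
    {f : EuclideanSpace ℝ (Fin n) → ℝ} (h : ∀ z ∈ L, Integrable (weightedMonomial s z.2 f)) :
    ∫ x, weightedPolynomial s L f x =
      (L.map fun z => z.1 * ∫ x, weightedMonomial s z.2 f x).sum := by
  induction L with
  | nil => simp [weightedPolynomial]
  | cons z L ih =>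
    have hL : ∀ w ∈ L, Integrable (weightedMonomial s w.2 f) := fun w hw => h w (by simp [hw])
    have h' := integral_add ((h z (by simp)).const_mul z.1) (integrable_weightedPolynomial hL)
    rw [ih hL, integral_const_mul] at h'
    simpa [weightedPolynomial] using h'

lemma continuous_weightedPolynomial {s : ℝ} {L : List (ℝ × List (List (Fin n)))}
    {f : EuclideanSpace ℝ (Fin n) → ℝ} (h : ∀ Js, Continuous (weightedMonomial s Js f)) :
    Continuous (weightedPolynomial s L f) := by
  induction L with
  | nil => exact continuous_const
  | cons z L ih => exact (continuous_const.mul (h z.2)).add ih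

/-- The terms of the square of the `(a, b)` entry of the pressure Hessian. -/
def hessianTerms {n : ℕ} (p : ℝ) (a b : Fin n) : List (ℝ × List (List (Fin n))) :=
  [(1, [[a, b], [a, b]]), (2 * (p - 2), [[a], [b], [a, b]]), ((p - 2) ^ 2, [[a], [a], [b], [b]])]

/-- The terms of the squared trace of the pressure Hessian, the cross terms being collected
asymmetrically, which is immaterial after summation over `a` and `b`. -/
def laplacianTerms {n : ℕ} (p : ℝ) (a b : Fin n) : List (ℝ × List (List (Fin n))) :=
  [(1, [[a, a], [b, b]]), (2 * (p - 2), [[a], [a], [b, b]]), ((p - 2) ^ 2, [[a], [a], [b], [b]])]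

lemma totalOrder_hessianTerms (p : ℝ) (a b : Fin n) :
    ∀ z ∈ hessianTerms p a b, totalOrder z.2 = 4 := by
  simp [hessianTerms, totalOrder]

lemma totalOrder_laplacianTerms (p : ℝ) (a b : Fin n) :
    ∀ z ∈ laplacianTerms p a b, totalOrder z.2 = 4 := by
  simp [laplacianTerms, totalOrder]

lemma rpow_mul_sum_pressureHessian_sq (p : ℝ) (f : EuclideanSpace ℝ (Fin n) → ℝ)
    (x : EuclideanSpace ℝ (Fin n)) :
    f x ^ (3 * p - 2) * ∑ a, ∑ b, pressureHessian p f a b x ^ 2 =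
      ∑ a, ∑ b, weightedPolynomial (3 * p - 2) (hessianTerms p a b) f x := by
  simp only [Finset.mul_sum]
  refine Finset.sum_congr rfl fun a _ => Finset.sum_congr rfl fun b _ => ?_
  simp [hessianTerms, weightedPolynomial, weightedMonomial, pressureHessian]
  ring

lemma rpow_mul_trace_pressureHessian_sq (p : ℝ) (f : EuclideanSpace ℝ (Fin n) → ℝ)
    (x : EuclideanSpace ℝ (Fin n)) :
    f x ^ (3 * p - 2) * (∑ a, pressureHessian p f a a x) ^ 2 =
      ∑ a, ∑ b, weightedPolynomial (3 * p - 2) (laplacianTerms p a b) f x := by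
  have e : ∀ a b, weightedPolynomial (3 * p - 2) (laplacianTerms p a b) f x = f x ^ (3 * p - 2) *
      (iterPartial [a, a] f x / f x * (iterPartial [b, b] f x / f x) +
        2 * (p - 2) * ((iterPartial [a] f x / f x) ^ 2 * (iterPartial [b, b] f x / f x)) +
        (p - 2) ^ 2 * ((iterPartial [a] f x / f x) ^ 2 * (iterPartial [b] f x / f x) ^ 2)) := by
    intro a b
    simp [laplacianTerms, weightedPolynomial, weightedMonomial]
    ring
  simp only [e, pressureHessian, ← Finset.mul_sum, ← sq, Finset.sum_add_distrib, ← Finset.sum_mul]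
  ring

namespace IsDecayingSolution

/-! ### Evolution of `∫ u ^ p` and of the Fisher information -/

lemma hasDerivAt_integral_rpow (hu : IsDecayingSolution I p u) (hI : IsOpen I) {t : ℝ}
    (ht : t ∈ I) :
    HasDerivAt (fun s => ∫ x, u s x ^ p) (p ^ 2 * (1 - p) * fisherInfo p (u t)) t := by
  set L : Fin n → List (ℝ × List (List (Fin n))) := fun b =>
    [(p ^ 2, [[b, b]]), (p ^ 2 * (p - 1), [[b], [b]])] with hL
  have horder : ∀ b, ∀ z ∈ L b, totalOrder z.2 = 2 := by
    simp [hL, totalOrder]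
  have hder : HasDerivAt (fun s => ∫ x, u s x ^ p)
      (∫ x, ∑ b, weightedPolynomial (2 * p - 1) (L b) (u t) x) t := by
    refine hasDerivAt_integral_of_locallyDominated hI ht
      (F' := fun t x => ∑ b, weightedPolynomial (2 * p - 1) (L b) (u t) x) (fun s hs => ?_)
      (hu.integrable_rpow t ht) ?_ ?_ ?_
    · exact (hu.contDiff hI hs).continuous.rpow_const fun x => Or.inl (hu.pos s hs x).ne'
    · exact continuous_finsetSum _ fun b _ => continuous_weightedPolynomial
        (hu.continuous_weightedMonomial hI ht _)
    · exact LocallyDominated.sum _ fun b => locallyDominated_weightedPolynomial fun z hz =>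
        hu.dominated_two z.2 (horder b z hz)
    · intro s hs x
      have h0 := hu.pos s hs x
      convert (hu.hasDerivAt hI hs x).rpow_const_of_pos h0 p using 1
      rw [Finset.sum_div, Finset.mul_sum]
      refine Finset.sum_congr rfl fun b _ => ?_
      have e : u s x ^ (2 * p - 1) = u s x ^ p * u s x ^ p / u s x := by
        rw [show 2 * p - 1 = p + p - 1 by ring, Real.rpow_sub_one h0.ne', Real.rpow_add h0]
      simp [hL, weightedPolynomial, weightedMonomial, e]
      ring
  convert hder using 1
  have hint : ∀ b, ∀ z ∈ L b, Integrable (weightedMonomial (2 * p - 1) z.2 (u t)) :=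
    fun b z hz => hu.integrable_two hI ht (horder b z hz)
  rw [integral_finsetSum _ fun b _ => integrable_weightedPolynomial (hint b), fisherInfo,
    Finset.mul_sum]
  refine Finset.sum_congr rfl fun b _ => ?_
  rw [integral_weightedPolynomial (hint b)]
  have h := hu.integral_parts_one hI ht b
  simp [hL]
  linear_combination (-p ^ 2) * h

/-- The Fisher information dissipates the squared Hessian and Laplacian of the pressure: all
derivatives of order three cancel after integration by parts. -/
lemma hasDerivAt_fisherInfo (hu : IsDecayingSolution I p u) (hI : IsOpen I) {t : ℝ}
    (ht : t ∈ I) :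
    HasDerivAt (fun s => fisherInfo p (u s))
      (-2 * (hessianEnergy p (u t) + (p - 1) * laplacianEnergy p (u t))) t := by
  have hf := hu.contDiff hI ht
  set L : Fin n → Fin n → List (ℝ × List (List (Fin n))) := fun a b =>
    [((2 * p - 3) * p + 2 * p * (p - 1), [[a], [a], [b, b]]),
      ((2 * p - 3) * p * (p - 1) + 2 * p * (p - 1) * (p - 2), [[a], [a], [b], [b]]),
      (2 * p, [[a], [a, b, b]]), (4 * p * (p - 1), [[a], [b], [a, b]])] with hL
  have horder : ∀ a b, ∀ z ∈ L a b, totalOrder z.2 = 4 := by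
    simp [hL, totalOrder]
  have hint : ∀ a b, ∀ z ∈ L a b, Integrable (weightedMonomial (3 * p - 2) z.2 (u t)) :=
    fun a b z hz => hu.integrable_four hI ht (horder a b z hz)
  have hintH := fun a b z hz => hu.integrable_four hI ht (totalOrder_hessianTerms p a b z hz)
  have hintL := fun a b z hz => hu.integrable_four hI ht (totalOrder_laplacianTerms p a b z hz)
  have hder : ∀ a, HasDerivAt (fun s => ∫ x, weightedMonomial (2 * p - 1) [[a], [a]] (u s) x)
      (∫ x, ∑ b, weightedPolynomial (3 * p - 2) (L a b) (u t) x) t := by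
    intro a
    refine hasDerivAt_integral_of_locallyDominated hI ht
      (F' := fun t x => ∑ b, weightedPolynomial (3 * p - 2) (L a b) (u t) x)
      (fun s hs => hu.continuous_weightedMonomial hI hs _ _) (hu.integrable_two hI ht rfl) ?_ ?_ ?_
    · exact continuous_finsetSum _ fun b _ => continuous_weightedPolynomial
        (hu.continuous_weightedMonomial hI ht _)
    · exact LocallyDominated.sum _ fun b => locallyDominated_weightedPolynomial fun z hz =>
        hu.dominated_four z.2 (horder a b z hz)
    · intro s hs x
      have h0 := hu.pos s hs x
      have h1 := hu.hasDerivAt hI hs x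
      have h2 := hu.hasDerivAt_partialDeriv hI hs x a
      rw [hu.partialDeriv_rhs hI hs x a] at h2
      have h3 := h1.div_of_pos h2 h0
      have h4 := (h1.rpow_const_of_pos h0 (2 * p - 1)).fun_mul (h3.fun_mul h3)
      have e1 : (fun s => weightedMonomial (2 * p - 1) [[a], [a]] (u s) x) = fun s =>
          u s x ^ (2 * p - 1) * (partialDeriv a (u s) x / u s x * (partialDeriv a (u s) x / u s x)) := by
        ext s; simp [weightedMonomial, iterPartial]
      rw [e1]
      refine h4.congr_deriv (Eq.symm ?_)
      have e : u s x ^ (3 * p - 2) = u s x ^ (2 * p - 1) * u s x ^ p / u s x := by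
        rw [show 3 * p - 2 = 2 * p - 1 + p - 1 by ring, Real.rpow_sub_one h0.ne', Real.rpow_add h0]
      have e2 : ∀ X Y q r v : ℝ, (2 * p - 1) * r * (X / v) * (q * q) +
          r * ((Y / v - q * (X / v)) * q + q * (Y / v - q * (X / v))) =
          (2 * p - 3) * r * q * q / v * X + 2 * r * q / v * Y := by
        intro X Y q r v; ring
      rw [e2, Finset.mul_sum, Finset.mul_sum, ← Finset.sum_add_distrib]
      refine Finset.sum_congr rfl fun b _ => ?_
      simp [hL, weightedPolynomial, weightedMonomial, e, iterPartial]
      ring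
  have hsum : HasDerivAt (fun s => fisherInfo p (u s))
      (∑ a, ∫ x, ∑ b, weightedPolynomial (3 * p - 2) (L a b) (u t) x) t :=
    HasDerivAt.fun_sum fun a _ => hder a
  convert hsum using 1
  have hH : hessianEnergy p (u t) =
      ∑ a, ∑ b, ∫ x, weightedPolynomial (3 * p - 2) (hessianTerms p a b) (u t) x := by
    rw [← Finset.sum_congr rfl fun a _ => integral_finsetSum _ fun b _ =>
        integrable_weightedPolynomial (hintH a b),
      ← integral_finsetSum _ fun a _ => integrable_finsetSum _ fun b _ =>
        integrable_weightedPolynomial (hintH a b)]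
    simp only [hessianEnergy, rpow_mul_sum_pressureHessian_sq]
  have hY : laplacianEnergy p (u t) =
      ∑ a, ∑ b, ∫ x, weightedPolynomial (3 * p - 2) (laplacianTerms p a b) (u t) x := by
    rw [← Finset.sum_congr rfl fun a _ => integral_finsetSum _ fun b _ =>
        integrable_weightedPolynomial (hintL a b),
      ← integral_finsetSum _ fun a _ => integrable_finsetSum _ fun b _ =>
        integrable_weightedPolynomial (hintL a b)]
    simp only [laplacianEnergy, rpow_mul_trace_pressureHessian_sq]
  rw [hH, hY]
  simp only [integral_weightedPolynomial (hintH _ _), integral_weightedPolynomial (hintL _ _),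
    integral_finsetSum _ fun b _ => integrable_weightedPolynomial (hint _ b),
    integral_weightedPolynomial (hint _ _)]
  set W : List (List (Fin n)) → ℝ := fun Js => ∫ x, weightedMonomial (3 * p - 2) Js (u t) x with hW
  have D₁ : ∀ a b, (3 * p - 5) * W [[a], [a], [b], [b]] + W [[b], [b], [a, a]] +
      2 * W [[a], [b], [a, b]] = 0 := by
    intro a b
    have h := hu.integral_parts_three hI ht a [a] [b] [b] rfl
    have e1 : weightedMonomial (3 * p - 2) [[a, a], [b], [b]] (u t) =
        weightedMonomial (3 * p - 2) [[b], [b], [a, a]] (u t) := by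
      ext x
      simp only [weightedMonomial, List.map_cons, List.map_nil, List.prod_cons, List.prod_nil]
      ring
    have e2 : weightedMonomial (3 * p - 2) [[a], [a, b], [b]] (u t) =
        weightedMonomial (3 * p - 2) [[a], [b], [a, b]] (u t) := by
      ext x
      simp only [weightedMonomial, List.map_cons, List.map_nil, List.prod_cons, List.prod_nil]
      ring
    rw [e1, e2] at h
    linear_combination h
  have D₂ : ∀ a b, (3 * p - 4) * W [[a], [b], [a, b]] + W [[a, b], [a, b]] +
      W [[a], [a, b, b]] = 0 := by
    intro a b
    have h := hu.integral_parts_two hI ht b [a] [b, a] rfl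
    have s1 := iterPartial_swap hf b a []
    have s2 := iterPartial_rotate hf a b
    have e1 : weightedMonomial (3 * p - 2) [[b], [a], [b, a]] (u t) =
        weightedMonomial (3 * p - 2) [[a], [b], [a, b]] (u t) := by
      ext x
      simp only [weightedMonomial, List.map_cons, List.map_nil, List.prod_cons, List.prod_nil, s1]
      ring
    have e2 : weightedMonomial (3 * p - 2) [[b, a], [b, a]] (u t) =
        weightedMonomial (3 * p - 2) [[a, b], [a, b]] (u t) := by
      ext x; simp [weightedMonomial, s1]
    have e3 : weightedMonomial (3 * p - 2) [[a], [b, b, a]] (u t) =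
        weightedMonomial (3 * p - 2) [[a], [a, b, b]] (u t) := by
      ext x; simp [weightedMonomial, s2]
    rw [e1, e2, e3] at h
    exact h
  have D₃ : ∀ a b, (3 * p - 4) * W [[a], [a], [b, b]] + W [[a, a], [b, b]] +
      W [[a], [a, b, b]] = 0 := fun a b => hu.integral_parts_two hI ht a [a] [b, b] rfl
  have S₁ := Finset.sum_congr rfl fun a (_ : a ∈ Finset.univ) =>
    Finset.sum_congr rfl fun b (_ : b ∈ Finset.univ) => D₁ a b
  have S₂ := Finset.sum_congr rfl fun a (_ : a ∈ Finset.univ) =>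
    Finset.sum_congr rfl fun b (_ : b ∈ Finset.univ) => D₂ a b
  have S₃ := Finset.sum_congr rfl fun a (_ : a ∈ Finset.univ) =>
    Finset.sum_congr rfl fun b (_ : b ∈ Finset.univ) => D₃ a b
  have C : ∑ a, ∑ b, W [[b], [b], [a, a]] = ∑ a, ∑ b, W [[a], [a], [b, b]] := Finset.sum_comm
  simp only [Finset.sum_add_distrib, ← Finset.mul_sum, Finset.sum_const_zero, C] at S₁ S₂ S₃
  simp only [hessianTerms, laplacianTerms, hL, List.map_cons, List.map_nil, List.sum_cons,
    List.sum_nil, add_zero, Finset.sum_add_distrib, ← Finset.mul_sum]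
  -- the multiplier of `S₂` removes the squared Hessian, that of `S₃` the squared Laplacian; the
  -- third-order terms then cancel, and the mixed second-order term fixes the multiplier of `S₁`
  linear_combination (-(2 * p ^ 2 - 3 * p)) * S₁ - 2 * S₂ - 2 * (p - 1) * S₃

/-! ### The two inequalities -/

lemma integrable_laplacianEnergy (hu : IsDecayingSolution I p u) (hI : IsOpen I) {t : ℝ}
    (ht : t ∈ I) :
    Integrable fun x => u t x ^ (3 * p - 2) * (∑ a, pressureHessian p (u t) a a x) ^ 2 := by
  simp only [rpow_mul_trace_pressureHessian_sq]
  exact integrable_finsetSum _ fun a _ => integrable_finsetSum _ fun b _ =>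
    integrable_weightedPolynomial fun z hz =>
      hu.integrable_four hI ht (totalOrder_laplacianTerms p a b z hz)

lemma integrable_hessianEnergy (hu : IsDecayingSolution I p u) (hI : IsOpen I) {t : ℝ}
    (ht : t ∈ I) :
    Integrable fun x => u t x ^ (3 * p - 2) * ∑ a, ∑ b, pressureHessian p (u t) a b x ^ 2 := by
  simp only [rpow_mul_sum_pressureHessian_sq]
  exact integrable_finsetSum _ fun a _ => integrable_finsetSum _ fun b _ =>
    integrable_weightedPolynomial fun z hz =>
      hu.integrable_four hI ht (totalOrder_hessianTerms p a b z hz)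

/-- The trace inequality `(tr M)² ≤ n |M|²`, integrated. -/
lemma laplacianEnergy_le (hu : IsDecayingSolution I p u) (hI : IsOpen I) {t : ℝ} (ht : t ∈ I) :
    laplacianEnergy p (u t) ≤ n * hessianEnergy p (u t) := by
  unfold laplacianEnergy hessianEnergy
  rw [← integral_const_mul]
  refine integral_mono (hu.integrable_laplacianEnergy hI ht)
    ((hu.integrable_hessianEnergy hI ht).const_mul _) fun x => ?_
  have h0 : 0 ≤ u t x ^ (3 * p - 2) := Real.rpow_nonneg (hu.pos t ht x).le _
  have h1 : (∑ a, pressureHessian p (u t) a a x) ^ 2 ≤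
      n * ∑ a, pressureHessian p (u t) a a x ^ 2 := by
    simpa using sq_sum_le_card_mul_sum_sq (s := Finset.univ)
      (f := fun a => pressureHessian p (u t) a a x)
  have h2 : ∑ a, pressureHessian p (u t) a a x ^ 2 ≤
      ∑ a, ∑ b, pressureHessian p (u t) a b x ^ 2 :=
    Finset.sum_le_sum fun a _ => Finset.single_le_sum
      (f := fun b => pressureHessian p (u t) a b x ^ 2) (fun b _ => sq_nonneg _) (Finset.mem_univ a)
  calc u t x ^ (3 * p - 2) * (∑ a, pressureHessian p (u t) a a x) ^ 2
      ≤ u t x ^ (3 * p - 2) * (n * ∑ a, ∑ b, pressureHessian p (u t) a b x ^ 2) := by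
        gcongr
        exact h1.trans (by gcongr)
    _ = _ := by ring

/-- The Cauchy–Schwarz inequality, for the Fisher information written as `-∫ u ^ p Δv`. -/
lemma fisherInfo_sq_le (hu : IsDecayingSolution I p u) (hI : IsOpen I) {t : ℝ} (ht : t ∈ I) :
    p ^ 2 * fisherInfo p (u t) ^ 2 ≤ (∫ x, u t x ^ p) * laplacianEnergy p (u t) := by
  set L : Fin n → List (ℝ × List (List (Fin n))) := fun b => [(1, [[b, b]]), (p - 2, [[b], [b]])]
    with hL
  have hint : ∀ b, ∀ z ∈ L b, Integrable (weightedMonomial (2 * p - 1) z.2 (u t)) :=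
    fun b z hz => hu.integrable_two hI ht (by revert z; simp [hL, totalOrder])
  have hX : Integrable fun x => ∑ b, weightedPolynomial (2 * p - 1) (L b) (u t) x :=
    integrable_finsetSum _ fun b _ => integrable_weightedPolynomial (hint b)
  have hXv : ∫ x, ∑ b, weightedPolynomial (2 * p - 1) (L b) (u t) x = -(p * fisherInfo p (u t)) := by
    rw [integral_finsetSum _ fun b _ => integrable_weightedPolynomial (hint b), fisherInfo,
      Finset.mul_sum, ← Finset.sum_neg_distrib]
    refine Finset.sum_congr rfl fun b _ => ?_
    rw [integral_weightedPolynomial (hint b)]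
    have h := hu.integral_parts_one hI ht b
    simp [hL]
    linear_combination h
  have hE := hu.integrable_rpow t ht
  have hY := hu.integrable_laplacianEnergy hI ht
  -- the quadratic `c ↦ ∫ u ^ p (c + u ^ (p - 1) tr M)²` is nonnegative, `M` the pressure Hessian
  have key : ∀ c : ℝ, 0 ≤ (∫ x, u t x ^ p) * (c * c) + (-(2 * p * fisherInfo p (u t))) * c +
      laplacianEnergy p (u t) := by
    intro c
    have hsq : ∀ x, 0 ≤ c ^ 2 * u t x ^ p +
        2 * c * (∑ b, weightedPolynomial (2 * p - 1) (L b) (u t) x) +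
        u t x ^ (3 * p - 2) * (∑ a, pressureHessian p (u t) a a x) ^ 2 := by
      intro x
      have h0 := hu.pos t ht x
      have e1 : u t x ^ (2 * p - 1) = u t x ^ p * u t x ^ (p - 1) := by
        rw [← Real.rpow_add h0]; ring_nf
      have e2 : u t x ^ (3 * p - 2) = u t x ^ p * u t x ^ (p - 1) * u t x ^ (p - 1) := by
        rw [← Real.rpow_add h0, ← Real.rpow_add h0]; ring_nf
      have e3 : ∑ b, weightedPolynomial (2 * p - 1) (L b) (u t) x =
          u t x ^ (2 * p - 1) * ∑ a, pressureHessian p (u t) a a x := by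
        rw [Finset.mul_sum]
        refine Finset.sum_congr rfl fun b _ => ?_
        simp [hL, weightedPolynomial, weightedMonomial, pressureHessian]
        ring
      rw [e3, e1, e2]
      have : 0 ≤ u t x ^ p * (c + u t x ^ (p - 1) * ∑ a, pressureHessian p (u t) a a x) ^ 2 := by
        positivity
      linarith
    have h12 : Integrable fun x => c ^ 2 * u t x ^ p +
        2 * c * (∑ b, weightedPolynomial (2 * p - 1) (L b) (u t) x) :=
      (hE.const_mul _).add (hX.const_mul _)
    have h : 0 ≤ ∫ x, (c ^ 2 * u t x ^ p +
        2 * c * (∑ b, weightedPolynomial (2 * p - 1) (L b) (u t) x) +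
        u t x ^ (3 * p - 2) * (∑ a, pressureHessian p (u t) a a x) ^ 2) := integral_nonneg hsq
    rw [integral_add h12 hY, integral_add (hE.const_mul _) (hX.const_mul _), integral_const_mul,
      integral_const_mul, hXv] at h
    unfold laplacianEnergy
    linarith
  have h := discrim_le_zero key
  unfold discrim at h
  linarith

lemma integral_rpow_pos (hu : IsDecayingSolution I p u) {t : ℝ} (ht : t ∈ I) :
    0 < ∫ x, u t x ^ p := by
  rw [integral_pos_iff_support_of_nonneg (fun x => Real.rpow_nonneg (hu.pos t ht x).le _)
    (hu.integrable_rpow t ht)]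
  have : (Function.support fun x => u t x ^ p) = Set.univ :=
    Set.eq_univ_of_forall fun x => (Real.rpow_pos_of_pos (hu.pos t ht x) _).ne'
  rw [this]
  exact isOpen_univ.measure_pos _ Set.univ_nonempty

/-! ### The entropy power -/

lemma renyiEntropyPower_eq (hu : IsDecayingSolution I p u) {t : ℝ} (ht : t ∈ I) (μ : ℝ) :
    renyiEntropyPower p μ (u t) = (∫ x, u t x ^ p) ^ (μ / n * (1 / (1 - p))) := by
  rw [Real.rpow_def_of_pos (hu.integral_rpow_pos ht), renyiEntropyPower, renyiEntropy]
  ring_nf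

lemma hasDerivAt_renyiEntropyPower (hu : IsDecayingSolution I p u) (hI : IsOpen I) (hp : p ≠ 1)
    (μ : ℝ) {t : ℝ} (ht : t ∈ I) :
    HasDerivAt (fun s => renyiEntropyPower p μ (u s))
      (μ / n * p ^ 2 * ((∫ x, u t x ^ p) ^ (μ / n * (1 / (1 - p)) - 1) * fisherInfo p (u t))) t := by
  have h := (hu.hasDerivAt_integral_rpow hI ht).rpow_const (p := μ / n * (1 / (1 - p)))
    (Or.inl (hu.integral_rpow_pos ht).ne')
  have h' := h.congr_of_eventuallyEq (f₁ := fun s => renyiEntropyPower p μ (u s))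
    (by filter_upwards [hI.mem_nhds ht] with s hs using hu.renyiEntropyPower_eq hs μ)
  refine h'.congr_deriv ?_
  have hp' : 1 - p ≠ 0 := sub_ne_zero.2 hp.symm
  -- the factor `1 - p` of `hasDerivAt_integral_rpow` cancels the one in the exponent
  have e : (1 - p) * (1 / (1 - p)) = 1 := by field_simp
  linear_combination (p ^ 2 * fisherInfo p (u t) * (μ / n) *
    (∫ x, u t x ^ p) ^ (μ / n * (1 / (1 - p)) - 1)) * e

lemma hasDerivAt_deriv_renyiEntropyPower (hu : IsDecayingSolution I p u) (hI : IsOpen I)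
    (hp : p ≠ 1) (μ : ℝ) {t : ℝ} (ht : t ∈ I) :
    HasDerivAt (deriv fun s => renyiEntropyPower p μ (u s))
      (μ / n * p ^ 2 * (∫ x, u t x ^ p) ^ (μ / n * (1 / (1 - p)) - 2) *
        ((μ / n - 1 + p) * p ^ 2 * fisherInfo p (u t) ^ 2 - 2 * (∫ x, u t x ^ p) *
          (hessianEnergy p (u t) + (p - 1) * laplacianEnergy p (u t)))) t := by
  have hE := hu.integral_rpow_pos ht
  have h := (((hu.hasDerivAt_integral_rpow hI ht).rpow_const (p := μ / n * (1 / (1 - p)) - 1)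
    (Or.inl hE.ne')).fun_mul (hu.hasDerivAt_fisherInfo hI ht)).const_mul (μ / n * p ^ 2)
  have h' := h.congr_of_eventuallyEq (f₁ := deriv fun s => renyiEntropyPower p μ (u s))
    (by filter_upwards [hI.mem_nhds ht] with s hs using
      (hu.hasDerivAt_renyiEntropyPower hI hp μ hs).deriv)
  refine h'.congr_deriv ?_
  have hp' : 1 - p ≠ 0 := sub_ne_zero.2 hp.symm
  have e : (1 - p) * (1 / (1 - p)) = 1 := by field_simp
  set σ := μ / n * (1 / (1 - p)) with hσ
  have e1 : (∫ x, u t x ^ p) ^ (σ - 1) = (∫ x, u t x ^ p) ^ (σ - 2) * ∫ x, u t x ^ p := by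
    rw [show σ - 1 = σ - 2 + 1 by ring, Real.rpow_add_one hE.ne']
  have e2 : (σ - 1) * (1 - p) = μ / n - 1 + p := by
    linear_combination (μ / n) * e
  rw [e1, show σ - 1 - 1 = σ - 2 by ring, ← e2]
  ring

/-- The sign of the second derivative: with `E = ∫ u ^ p`, `β` the Fisher information and `Y` the
Laplacian energy, the trace and Cauchy–Schwarz inequalities bound the bracket by
`(μ / n - 2 / n - (p - 1)) p² β²`. -/
lemma deriv2_renyiEntropyPower_nonpos (hu : IsDecayingSolution I p u) (hI : IsOpen I)
    (hn : 1 ≤ n) (hp : p ≠ 1) (hp1 : 1 - 1 / (n : ℝ) ≤ p) {μ : ℝ} (hμ : 0 ≤ μ)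
    (hμ' : μ ≤ 2 + n * (p - 1)) {t : ℝ} (ht : t ∈ I) :
    deriv (deriv fun s => renyiEntropyPower p μ (u s)) t ≤ 0 := by
  rw [(hu.hasDerivAt_deriv_renyiEntropyPower hI hp μ ht).deriv]
  have hn' : (0 : ℝ) < n := by exact_mod_cast hn
  have hE := hu.integral_rpow_pos ht
  have hYP := hu.laplacianEnergy_le hI ht
  have hCS := hu.fisherInfo_sq_le hI ht
  set E := ∫ x, u t x ^ p
  set β := fisherInfo p (u t)
  set P := hessianEnergy p (u t)
  set Y := laplacianEnergy p (u t)
  have h1 : (1 / (n : ℝ) + (p - 1)) * (E * Y) ≤ E * (P + (p - 1) * Y) := by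
    have : 1 / (n : ℝ) * Y ≤ P := by
      rw [one_div, inv_mul_le_iff₀ hn']; exact hYP
    have := mul_le_mul_of_nonneg_left this hE.le
    linarith
  have h2 : (1 / (n : ℝ) + (p - 1)) * (p ^ 2 * β ^ 2) ≤ (1 / (n : ℝ) + (p - 1)) * (E * Y) :=
    mul_le_mul_of_nonneg_left hCS (by linarith)
  have h3 : μ / n ≤ 2 * (1 / (n : ℝ)) + (p - 1) := by
    rw [div_le_iff₀ hn', add_mul, mul_assoc, one_div, inv_mul_cancel₀ hn'.ne']
    linarith
  have h4 : (μ / n - 1 + p) * (p ^ 2 * β ^ 2) ≤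
      2 * (1 / (n : ℝ) + (p - 1)) * (p ^ 2 * β ^ 2) :=
    mul_le_mul_of_nonneg_right (by linarith) (by positivity)
  refine mul_nonpos_of_nonneg_of_nonpos ?_ (by linarith)
  have := (Real.rpow_pos_of_pos hE (μ / n * (1 / (1 - p)) - 2)).le
  positivity

end IsDecayingSolution

theorem theorem3p1 (n : ℕ) (hn : 1 ≤ n) (p μ : ℝ) (hμ : 0 ≤ μ)
    (hΦ : RenyiParam.Φ (n : ℝ) p μ)
    (I : Set ℝ) (hIo : IsOpen I) (hIc : I.OrdConnected)
    (u : ℝ → EuclideanSpace ℝ (Fin n) → ℝ) (hu : IsDecayingSolution I p u) :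
    DifferentiableOn ℝ (fun t => renyiEntropyPower p μ (u t)) I ∧
      DifferentiableOn ℝ (deriv fun t => renyiEntropyPower p μ (u t)) I ∧
      (∀ t ∈ I, deriv (deriv fun s => renyiEntropyPower p μ (u s)) t ≤ 0) ∧
      ConcaveOn ℝ I (fun t => renyiEntropyPower p μ (u t)) := by
  obtain ⟨hp, hp1, hμ'⟩ := hΦ.bounds hn
  have hd1 : DifferentiableOn ℝ (fun t => renyiEntropyPower p μ (u t)) I := fun t ht =>
    (hu.hasDerivAt_renyiEntropyPower hIo hp μ ht).differentiableAt.differentiableWithinAt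
  have hd2 : DifferentiableOn ℝ (deriv fun t => renyiEntropyPower p μ (u t)) I := fun t ht =>
    (hu.hasDerivAt_deriv_renyiEntropyPower hIo hp μ ht).differentiableAt.differentiableWithinAt
  have hle : ∀ t ∈ I, deriv (deriv fun s => renyiEntropyPower p μ (u s)) t ≤ 0 := fun t ht =>
    hu.deriv2_renyiEntropyPower_nonpos hIo hn hp hp1 hμ hμ' ht
  exact ⟨hd1, hd2, hle, concaveOn_of_deriv2_nonpos' hIc.convex hd1 hd2 hle⟩
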